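/- Let $\Omega\subset\mathbb{R}^d$ be a bounded open connected (nonempty) set with $\partial\Omega\in C^1$, let $T>0$ and $Q=\Omega\times(0,T]$. Assume: (A1) $\mathcal{D}\in C^1(\mathbb{R}^2)$ and $0<\mathcal{D}_m\le \mathcal{D}\le \mathcal{D}_M<\infty$ for constants $\mathcal{D}_m,\mathcal{D}_M$; (A2) $F:\mathbb{R}^2\to\mathbb{R}^d$ has $C^1$ components and $|F|\le F_M$ for some $F_M>0$; (A3) there are constants $\Psi_u,\Psi_v>0$ such that for $j\in\{1,2\}$, $|\Psi_j(u_1,v_1)-\Psi_j(u_2,v_2)|\le \Psi_u|u_1-u_2|+\Psi_v|v_1-v_2|$ for all $u_1,u_2,v_1,v_2\in\mathbb{R}$, and $\Psi_1,\Psi_2:\mathbb{R}^2\to\mathbb{R}$ are nonincreasing in each of their two variables; (A4) $u_0\in L^\infty(\Omega)$, $v_0\in H^1(\Omega)\cap L^\infty(\Omega)$, and $\Psi_2(0,v_0)=0$ on $\partial\Omega$ in the sense of traces, i.e. $\Psi_2(0,v_0)\in H^1_0(\Omega)$. A weak solution is a pair $(u,v)$ with $u\in L^2(0,T;H^1_0(\Omega))$,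 $\partial_t u\in L^2(0,T;H^{-1}(\Omega))$, $v\in H^1(0,T;L^2(\Omega))\cap L^2(0,T;H^1(\Omega))$, $u(0)=u_0$, $v(0)=v_0$ (values at $t=0$ of the representatives in $C([0,T];L^2(\Omega))$), such that for all $\phi\in L^2(0,T;H^1_0(\Omega))$ and $\xi\in L^2(Q)$ $$\int_0^T\langle\partial_t u,\phi\rangle\,dt+\int_0^T\!\!\int_\Omega \mathcal{D}(u,v)\nabla u\cdot\nabla\phi\,dx\,dt=\int_0^T\!\!\int_\Omega F(u,v)\cdot\nabla\phi\,dx\,dt+\int_0^T\!\!\int_\Omega\Psi_1(u,v)\,\phi\,dx\,dt,$$ $$\int_0^T\!\!\int_\Omega \partial_t v\,\xi\,dx\,dt=\int_0^T\!\!\int_\Omega\Psi_2(u,v)\,\xi\,dx\,dt.$$ **Proposition (maximum principle).** Suppose in addition that $F(u,v)=F(u)$ does not depend on $v$. Let $v_l$ and $v_r$ be the essential infimum and the essential supremum of $v_0$ over $\Omega$, and suppose that there are real numbers $u_l<u_r$ with $u_l\le 0\le u_r$ such that $u_0(x)\in[u_l,u_r]$ for almost all $x\in\Omega$ and $$\Psi_1(u_r,v_l)\le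 0\le\Psi_2(u_r,v_l),\qquad \Psi_2(u_l,v_r)\le 0\le\Psi_1(u_l,v_r).$$ Then every weak solution $(u,v)$ satisfies $v_l\le v\le v_r$ and $u_l\le u\le u_r$ almost everywhere in $Q$. -/

import Mathlib

open MeasureTheory Filter Topology Set
open scoped ContDiff Gradient RealInnerProductSpace ENNReal

noncomputable section

/-- Euclidean space `ℝ^d`. -/
abbrev Euc (d : ℕ) : Type := EuclideanSpace ℝ (Fin d)

/-- `∂Ω ∈ C¹`: near each boundary point, `Ω` is the sublevel set `{ρ < 0}` of a `C¹` function `ρ`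
whose derivative does not vanish at that point. -/
def HasC1Boundary {d : ℕ} (Ω : Set (Euc d)) : Prop :=
  ∀ x₀ ∈ frontier Ω, ∃ (N : Set (Euc d)) (ρ : Euc d → ℝ), IsOpen N ∧ x₀ ∈ N ∧
    ContDiffOn ℝ 1 ρ N ∧ fderiv ℝ ρ x₀ ≠ 0 ∧ ∀ x ∈ N, x ∈ Ω ↔ ρ x < 0

/-- `L²(Ω)`. -/
abbrev L2 {d : ℕ} (Ω : Set (Euc d)) : Type := Lp ℝ 2 (volume.restrict Ω)

/-- `L²(Ω)^d`. -/
abbrev L2Vec {d : ℕ} (Ω : Set (Euc d)) : Type := Lp (Euc d) 2 (volume.restrict Ω)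

/-- Pairs `(f, G)` in `L²(Ω) × L²(Ω)^d`, with the Hilbert norm `(‖f‖² + ‖G‖²)^{1/2}`.
An element `f` of `H¹(Ω)` is represented by the pair `(f, ∇f)`. -/
abbrev L2Pair {d : ℕ} (Ω : Set (Euc d)) : Type := WithLp 2 (L2 Ω × L2Vec Ω)

/-- `φ ∈ C_c^∞(Ω)`, for `Ω` an open set of a normed space. -/
def IsTestFunction {X : Type*} [NormedAddCommGroup X] [NormedSpace ℝ X] (Ω : Set X)
    (φ : X → ℝ) : Prop :=
  ContDiff ℝ ∞ φ ∧ HasCompactSupport φ ∧ tsupport φ ⊆ Ω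

/-- A test function times an `L²` function is integrable. -/
lemma integrable_test_smul {d : ℕ} {Ω : Set (Euc d)} {X : Type*} [NormedAddCommGroup X]
    [NormedSpace ℝ X] {φ : Euc d → ℝ} (hφ : Continuous φ) (hc : HasCompactSupport φ)
    (g : Lp X 2 (volume.restrict Ω)) :
    Integrable (fun x => φ x • g x) (volume.restrict Ω) := by
  have h1 : MemLp φ 2 (volume.restrict Ω) :=
    (hφ.memLp_of_hasCompactSupport (μ := volume) hc).restrict Ω
  exact memLp_one_iff_integrable.1 ((Lp.memLp g).smul h1)

/-- An `L²` function times the gradient of a test function is integrable. -/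
lemma integrable_smul_grad {d : ℕ} {Ω : Set (Euc d)} {φ : Euc d → ℝ}
    (hφ : IsTestFunction Ω φ) (f : L2 Ω) :
    Integrable (fun x => f x • ∇ φ x) (volume.restrict Ω) := by
  have hcont : Continuous (fun x => ∇ φ x) :=
    (InnerProductSpace.toDual ℝ (Euc d)).symm.continuous.comp
      (hφ.1.continuous_fderiv (by simp))
  have hsupp : HasCompactSupport (fun x => ∇ φ x) :=
    (hφ.2.1.fderiv ℝ).comp_left (g := (InnerProductSpace.toDual ℝ (Euc d)).symm) (map_zero _)
  have h1 : MemLp (fun x => ∇ φ x) 2 (volume.restrict Ω) :=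
    (hcont.memLp_of_hasCompactSupport (μ := volume) hsupp).restrict Ω
  exact memLp_one_iff_integrable.1 (h1.smul (Lp.memLp f))

/-- The Sobolev space `H¹(Ω)`: pairs `(f, G)` of `L²` functions such that `G` is the weak gradient
of `f` in `Ω`. -/
def H1 {d : ℕ} (Ω : Set (Euc d)) : Submodule ℝ (L2Pair Ω) where
  carrier := {p | ∀ φ : Euc d → ℝ, IsTestFunction Ω φ →
    ∫ x in Ω, p.fst x • ∇ φ x = -∫ x in Ω, φ x • p.snd x}
  zero_mem' := by
    intro φ hφ
    have e1 : ∀ᵐ x ∂(volume.restrict Ω), ((0 : L2Pair Ω).fst x) • ∇ φ x = 0 := by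
      filter_upwards [Lp.coeFn_zero ℝ 2 (volume.restrict Ω)] with x hx
      rw [show (0 : L2Pair Ω).fst = 0 from rfl, hx, Pi.zero_apply, zero_smul]
    have e2 : ∀ᵐ x ∂(volume.restrict Ω), φ x • ((0 : L2Pair Ω).snd x) = 0 := by
      filter_upwards [Lp.coeFn_zero (Euc d) 2 (volume.restrict Ω)] with x hx
      rw [show (0 : L2Pair Ω).snd = 0 from rfl, hx, Pi.zero_apply, smul_zero]
    rw [integral_congr_ae e1, integral_congr_ae e2]
    simp
  add_mem' := by
    intro p q hp hq φ hφ
    have e1 : ∀ᵐ x ∂(volume.restrict Ω), ((p + q).fst x) • ∇ φ x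
        = p.fst x • ∇ φ x + q.fst x • ∇ φ x := by
      filter_upwards [Lp.coeFn_add p.fst q.fst] with x hx
      rw [show (p + q).fst = p.fst + q.fst from rfl, hx, Pi.add_apply, add_smul]
    have e2 : ∀ᵐ x ∂(volume.restrict Ω), φ x • ((p + q).snd x)
        = φ x • p.snd x + φ x • q.snd x := by
      filter_upwards [Lp.coeFn_add p.snd q.snd] with x hx
      rw [show (p + q).snd = p.snd + q.snd from rfl, hx, Pi.add_apply, smul_add]
    rw [integral_congr_ae e1, integral_congr_ae e2,
      integral_add (integrable_smul_grad hφ p.fst) (integrable_smul_grad hφ q.fst),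
      integral_add (integrable_test_smul hφ.1.continuous hφ.2.1 p.snd)
        (integrable_test_smul hφ.1.continuous hφ.2.1 q.snd), hp φ hφ, hq φ hφ, neg_add]
  smul_mem' := by
    intro c p hp φ hφ
    have e1 : ∀ᵐ x ∂(volume.restrict Ω), ((c • p).fst x) • ∇ φ x = c • (p.fst x • ∇ φ x) := by
      filter_upwards [Lp.coeFn_smul c p.fst] with x hx
      rw [show (c • p).fst = c • p.fst from rfl, hx, Pi.smul_apply, smul_assoc]
    have e2 : ∀ᵐ x ∂(volume.restrict Ω), φ x • ((c • p).snd x) = c • (φ x • p.snd x) := by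
      filter_upwards [Lp.coeFn_smul c p.snd] with x hx
      rw [show (c • p).snd = c • p.snd from rfl, hx, Pi.smul_apply, smul_comm]
    rw [integral_congr_ae e1, integral_congr_ae e2, integral_smul, integral_smul, hp φ hφ, smul_neg]

/-- The Sobolev space `H¹₀(Ω)`: the closure of `C_c^∞(Ω)` in the norm of `H¹(Ω)`. -/
def H10 {d : ℕ} (Ω : Set (Euc d)) : Submodule ℝ (L2Pair Ω) :=
  (Submodule.span ℝ {p : L2Pair Ω | ∃ φ : Euc d → ℝ, IsTestFunction Ω φ ∧
    p.fst =ᵐ[volume.restrict Ω] φ ∧ p.snd =ᵐ[volume.restrict Ω] ∇ φ}).topologicalClosure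

/-- The dual space `H⁻¹(Ω)` of `H¹₀(Ω)`. -/
abbrev Hneg1 {d : ℕ} (Ω : Set (Euc d)) : Type := H10 Ω →L[ℝ] ℝ

/-- The function `f` on `Ω` belongs to `H¹(Ω)`. -/
def MemH1 {d : ℕ} (Ω : Set (Euc d)) (f : Euc d → ℝ) : Prop :=
  ∃ p ∈ H1 Ω, p.fst =ᵐ[volume.restrict Ω] f

/-- The function `f` on `Ω` belongs to `H¹₀(Ω)`. -/
def MemH10 {d : ℕ} (Ω : Set (Euc d)) (f : Euc d → ℝ) : Prop :=
  ∃ p ∈ H10 Ω, p.fst =ᵐ[volume.restrict Ω] f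

/-- The embedding `L²(Ω) ⊂ H⁻¹(Ω)`: the function `f` acts on `H¹₀(Ω)` by `w ↦ (f, w)`. -/
def L2.toHneg1 {d : ℕ} {Ω : Set (Euc d)} (f : L2 Ω) : Hneg1 Ω :=
  (innerSL ℝ f).comp ((WithLp.fstL 2 ℝ (L2 Ω) (L2Vec Ω)).comp (H10 Ω).subtypeL)

/-- Lebesgue measure on the time interval `(0, T)`. -/
abbrev timeMeasure (T : ℝ) : Measure ℝ := volume.restrict (Ioo 0 T)

/-- `g` is the weak (distributional) time derivative of `f` on `(0, T)`, with values in the Banach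
space `X`. It is applied below only to functions in `L²(0, T; X)`. -/
def HasWeakTimeDeriv {X : Type*} [NormedAddCommGroup X] [NormedSpace ℝ X] (T : ℝ)
    (f g : ℝ → X) : Prop :=
  ∀ η : ℝ → ℝ, IsTestFunction (Ioo 0 T) η →
    ∫ t, deriv η t • f t ∂(timeMeasure T) = -∫ t, η t • g t ∂(timeMeasure T)

/-- `w(0) = w₀` for a function `w` on `(0, T) × Ω` that has a representative in `C([0, T]; L²(Ω))`:
`w(t) → w₀` in `L²(Ω)` as `t ↓ 0`, up to a null set of times. This essential limit is the value at
`0` of the continuous representative. -/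
def HasInitialValue {d : ℕ} (Ω : Set (Euc d)) (w : ℝ → Euc d → ℝ) (w₀ : Euc d → ℝ) : Prop :=
  Tendsto (fun t => eLpNorm (w t - w₀) 2 (volume.restrict Ω)) (𝓝[>] 0 ⊓ ae volume) (𝓝 0)

/-- The function `w` on `(0, T) × Ω` is measurable and is represented by the `L²(Ω)`-valued
function `W` of time. -/
def Represents {d : ℕ} (Ω : Set (Euc d)) (T : ℝ) (w : ℝ → Euc d → ℝ) (W : ℝ → L2 Ω) : Prop :=
  AEStronglyMeasurable (Function.uncurry w) ((timeMeasure T).prod (volume.restrict Ω)) ∧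
  ∀ᵐ t ∂(timeMeasure T), w t =ᵐ[volume.restrict Ω] W t

/-- Weak solutions `(u, v)` on `Q = (0, T) × Ω` of
`∂ₜ u + ∇ · F(u,v) = ∇ · [D(u,v) ∇u] + Ψ₁(u,v)`, `∂ₜ v = Ψ₂(u,v)`, with `u = 0` on `∂Ω`,
`u(0) = u₀`, `v(0) = v₀`.

Here `U` and `V` are `u` and `v` as elements of `L²(0,T;H¹₀(Ω))` and `L²(0,T;H¹(Ω))` (so
`(U t).1.snd` is `∇u(t)`), and `U' ∈ L²(0,T;H⁻¹(Ω))`, `V' ∈ L²(0,T;L²(Ω))` are their time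
derivatives. -/
def IsWeakSolution {d : ℕ} (Ω : Set (Euc d)) (T : ℝ) (D : ℝ → ℝ → ℝ) (F : ℝ → ℝ → Euc d)
    (Ψ₁ Ψ₂ : ℝ → ℝ → ℝ) (u₀ v₀ : Euc d → ℝ) (u v : ℝ → Euc d → ℝ) : Prop :=
  ∃ (U : ℝ → H10 Ω) (V : ℝ → H1 Ω) (U' : ℝ → Hneg1 Ω) (V' : ℝ → L2 Ω),
    -- `u ∈ 𝒲`
    Represents Ω T u (fun t => (U t).1.fst) ∧
    MemLp U 2 (timeMeasure T) ∧ MemLp U' 2 (timeMeasure T) ∧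
    HasWeakTimeDeriv T (fun t => L2.toHneg1 (U t).1.fst) U' ∧
    -- `v ∈ H¹(0,T;L²(Ω)) ∩ L²(0,T;H¹(Ω))`
    Represents Ω T v (fun t => (V t).1.fst) ∧
    MemLp V 2 (timeMeasure T) ∧ MemLp V' 2 (timeMeasure T) ∧
    HasWeakTimeDeriv T (fun t => (V t).1.fst) V' ∧
    -- initial conditions
    HasInitialValue Ω u u₀ ∧ HasInitialValue Ω v v₀ ∧
    -- weak form of the equation for `u`
    (∀ φ : ℝ → H10 Ω, MemLp φ 2 (timeMeasure T) →
      (∫ t, U' t (φ t) ∂(timeMeasure T))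
        + (∫ t, (∫ x in Ω, D (u t x) (v t x) * ⟪(U t).1.snd x, (φ t).1.snd x⟫) ∂(timeMeasure T))
      = (∫ t, (∫ x in Ω, ⟪F (u t x) (v t x), (φ t).1.snd x⟫) ∂(timeMeasure T))
        + (∫ t, (∫ x in Ω, Ψ₁ (u t x) (v t x) * (φ t).1.fst x) ∂(timeMeasure T))) ∧
    -- weak form of the equation for `v`
    (∀ ξ : ℝ → L2 Ω, MemLp ξ 2 (timeMeasure T) →
      ∫ t, (∫ x in Ω, V' t x * ξ t x) ∂(timeMeasure T)
      = ∫ t, (∫ x in Ω, Ψ₂ (u t x) (v t x) * ξ t x) ∂(timeMeasure T))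

end

/-! The bounds `u ≤ u_r` and `v ≥ v_l` are proved together, because each reaction term is controlled
by the violation of the other bound. Put `P = (u - u_r)⁺` and `Q = (v_l - v)⁺`, and test the two
equations with `P` and `-Q`. The diffusion term has a sign. The flux does no work: as `F` depends on
`u` alone, `F(u) · ∇P` is the divergence of a function of `P ∈ H¹₀(Ω)`
(`integral_inner_comp_gradient_eq_zero`). Monotonicity, the Lipschitz bound and the signs at `(u_r,
v_l)` give `Ψ₁ ≤ L Q` where `u ≥ u_r` and `-Ψ₂ ≤ L P` where `v ≤ v_l` (`le_mul_max_of_antitone`). So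
both right-hand sides are at most `L ∫∫ P Q`, the energy `E = ‖P‖²/2 + ‖Q‖²/2` satisfies `E(s) ≤ 2L
∫₀ˢ E`, and Gronwall gives `E = 0` (`IsWeakSolution.le_and_ge`). The opposite bounds are the same
statement for `(-u, -v)`, since reflecting both unknowns preserves the structure of the system.

Two points carry the technical weight. In space, `P` must be an admissible test function with
gradient `1_{u > u_r} ∇u`. This is shown by smooth truncations and needs `u_r ≥ 0`, so that the
truncation vanishes at `0` (`L2Pair.chain_posPart_mem_H10`).

In time, no full chain rule is needed, only `‖P(s)‖²/2 ≤ ∫₀ˢ ⟨∂ₜu, P⟩`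
(`HasWeakTimeDeriv.energy_le`). This comes from convexity: if `φ(t)` is a subgradient at `U(t)`,
then `f(t) - f(t - h) ≤ ⟨U(t) - U(t - h), φ(t)⟩`, and the increment of `U` is an integral of `U'` by
du Bois-Reymond. Integrating in `t`, dividing by `h` and letting `h → 0` at Lebesgue points of `f`
gives the inequality. -/

/-! ### Weak time derivatives and the lemma of du Bois-Reymond -/

lemma exists_testFunction_integral_eq_one {T : ℝ} (hT : 0 < T) :
    ∃ ψ : ℝ → ℝ, IsTestFunction (Ioo 0 T) ψ ∧ ∫ t, ψ t = 1 := by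
  let b : ContDiffBump (T / 2) := ⟨T / 8, T / 4, by positivity, by linarith⟩
  refine ⟨b.normed volume, ⟨b.contDiff_normed, b.hasCompactSupport_normed, ?_⟩,
    b.integral_normed⟩
  rw [b.tsupport_normed_eq, Real.closedBall_eq_Icc]
  intro x hx
  have : b.rOut = T / 4 := rfl
  rw [this] at hx
  exact ⟨by linarith [hx.1], by linarith [hx.2]⟩

lemma exists_Icc_of_isCompact_subset_Ioo {T : ℝ} (hT : 0 < T) {K : Set ℝ} (hK : IsCompact K)
    (hKT : K ⊆ Ioo 0 T) : ∃ a b, 0 < a ∧ a ≤ b ∧ b < T ∧ K ⊆ Icc a b := by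
  -- Adding the midpoint makes the set nonempty, so that it has a least and a greatest element even
  -- when `K = ∅`.
  have hK' : IsCompact (insert (T / 2) K) := hK.insert _
  have hne : (insert (T / 2) K).Nonempty := insert_nonempty _ _
  have hsub : insert (T / 2) K ⊆ Ioo 0 T :=
    insert_subset ⟨by linarith, by linarith⟩ hKT
  obtain ⟨a, ha, hamin⟩ := hK'.exists_isLeast hne
  obtain ⟨b, hb, hbmax⟩ := hK'.exists_isGreatest hne
  exact ⟨a, b, (hsub ha).1, hamin hb, (hsub hb).2, fun x hx =>
    ⟨hamin (mem_insert_of_mem _ hx), hbmax (mem_insert_of_mem _ hx)⟩⟩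

/-- A test function with vanishing integral has a primitive which is a test function. -/
lemma IsTestFunction.exists_deriv_eq {T : ℝ} (hT : 0 < T) {ψ : ℝ → ℝ}
    (hψ : IsTestFunction (Ioo 0 T) ψ) (h0 : ∫ t, ψ t = 0) :
    ∃ η, IsTestFunction (Ioo 0 T) η ∧ deriv η = ψ := by
  obtain ⟨a, b, ha, hab, hbT, hK⟩ := exists_Icc_of_isCompact_subset_Ioo hT hψ.2.1 hψ.2.2
  have hcont := hψ.1.continuous
  have hder : ∀ t, HasDerivAt (fun t => ∫ s in (0:ℝ)..t, ψ s) (ψ t) t := fun t =>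
    (hcont.integral_hasStrictDerivAt 0 t).hasDerivAt
  have hderiv : deriv (fun t => ∫ s in (0:ℝ)..t, ψ s) = ψ := funext fun t => (hder t).deriv
  have hzero : ∀ t, t ∉ Icc a b → ψ t = 0 := fun t ht =>
    image_eq_zero_of_notMem_tsupport fun h => ht (hK h)
  -- The vanishing mean makes the primitive return to zero to the right of `b`.
  have htot : ∫ s in a..b, ψ s = 0 := by
    rw [intervalIntegral.integral_of_le hab, ← integral_Icc_eq_integral_Ioc,
      setIntegral_eq_integral_of_forall_compl_eq_zero hzero, h0]
  have hsmall : ∀ x y, (∀ t ∈ Ioo x y, t ∉ Icc a b) → x ≤ y → ∫ s in x..y, ψ s = 0 := by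
    intro x y h hxy
    rw [intervalIntegral.integral_of_le hxy, integral_Ioc_eq_integral_Ioo]
    exact setIntegral_eq_zero_of_forall_eq_zero fun t ht => hzero t (h t ht)
  have hint : ∀ x y, IntervalIntegrable ψ volume x y := fun x y => hcont.intervalIntegrable x y
  have hsupp : Function.support (fun t => ∫ s in (0:ℝ)..t, ψ s) ⊆ Icc a b := by
    intro t ht
    by_contra hmem
    apply ht
    rcases lt_or_ge t a with hta | hta
    · rcases le_total 0 t with h | h
      · exact hsmall 0 t (fun s hs hs' => by linarith [hs.2, hs'.1]) h
      · show ∫ s in (0:ℝ)..t, ψ s = 0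
        rw [intervalIntegral.integral_symm,
          hsmall t 0 (fun s hs hs' => by linarith [hs.2, hs'.1]) h, neg_zero]
    · have hbt : b ≤ t := by
        by_contra h
        exact hmem ⟨hta, (not_le.1 h).le⟩
      show ∫ s in (0:ℝ)..t, ψ s = 0
      rw [← intervalIntegral.integral_add_adjacent_intervals (hint 0 a) (hint a t),
        ← intervalIntegral.integral_add_adjacent_intervals (hint a b) (hint b t),
        hsmall 0 a (fun s hs hs' => by linarith [hs.2, hs'.1]) ha.le, htot,
        hsmall b t (fun s hs hs' => by linarith [hs.1, hs'.2]) hbt]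
      simp
  have htsupp := closure_minimal hsupp isClosed_Icc
  refine ⟨fun t => ∫ s in (0:ℝ)..t, ψ s, ⟨?_, ?_, ?_⟩, hderiv⟩
  · rw [contDiff_infty_iff_deriv, hderiv]
    exact ⟨fun t => (hder t).differentiableAt, hψ.1⟩
  · exact isCompact_Icc.of_isClosed_subset (isClosed_tsupport _) htsupp
  · exact htsupp.trans fun t ht => ⟨ha.trans_le ht.1, ht.2.trans_lt hbT⟩

lemma IsTestFunction.linear_comb {X : Type*} [NormedAddCommGroup X] [NormedSpace ℝ X]
    {Ω : Set X} {φ ψ : X → ℝ} (hφ : IsTestFunction Ω φ) (hψ : IsTestFunction Ω ψ) (c : ℝ) :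
    IsTestFunction Ω (fun x => φ x + c * ψ x) := by
  have hc : tsupport (fun x => c * ψ x) ⊆ tsupport ψ :=
    closure_mono fun x hx h => hx (by simp [h])
  refine ⟨hφ.1.add (contDiff_const.mul hψ.1), hφ.2.1.add hψ.2.1.mul_left, ?_⟩
  exact (tsupport_add φ fun x => c * ψ x).trans
    (union_subset hφ.2.2 (hc.trans hψ.2.2))

section DuBoisReymond

variable {X : Type*} [NormedAddCommGroup X] [NormedSpace ℝ X]

/-- Fubini on the triangle `s ≤ t`: for fixed `s`, the integral of `η'` from `s` to `T` is `-η s`,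
because `η T = 0`. No differentiability of the primitive is used. -/
lemma IsTestFunction.integral_deriv_smul_primitive [CompleteSpace X] {T : ℝ} {η : ℝ → ℝ}
    (hη : IsTestFunction (Ioo 0 T) η) {g : ℝ → X} (hg : Integrable g (timeMeasure T)) :
    ∫ t, deriv η t • (∫ s in (0:ℝ)..t, g s) ∂(timeMeasure T)
      = -∫ t, η t • g t ∂(timeMeasure T) := by
  have hη1 : ContDiff ℝ 1 η := hη.1.of_le (by simp)
  have hdc : Continuous (deriv η) := hη1.continuous_deriv le_rfl
  have hd : Integrable (deriv η) (timeMeasure T) :=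
    (hdc.integrable_of_hasCompactSupport hη.2.1.deriv).restrict
  have hηT : η T = 0 := image_eq_zero_of_notMem_tsupport fun h => lt_irrefl _ (hη.2.2 h).2
  have hmeas : MeasurableSet {p : ℝ × ℝ | p.2 ≤ p.1} :=
    measurableSet_le measurable_snd measurable_fst
  have hint : Integrable (Function.uncurry fun t s =>
      {p : ℝ × ℝ | p.2 ≤ p.1}.indicator (fun p => deriv η p.1 • g p.2) (t, s))
      ((timeMeasure T).prod (timeMeasure T)) := (hd.smul_prod hg).indicator hmeas
  have h1 : ∀ t ∈ Ioo 0 T, deriv η t • (∫ s in (0:ℝ)..t, g s)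
      = ∫ s, {p : ℝ × ℝ | p.2 ≤ p.1}.indicator (fun p => deriv η p.1 • g p.2) (t, s)
        ∂(timeMeasure T) := by
    intro t ht
    rw [intervalIntegral.integral_of_le ht.1.le, ← integral_smul, ← integral_indicator
      measurableSet_Ioc, ← integral_indicator measurableSet_Ioo]
    congr 1 with s
    by_cases h : s ≤ t
    · by_cases h0 : 0 < s
      · have hs1 : s ∈ Ioc 0 t := ⟨h0, h⟩
        have hs2 : s ∈ Ioo 0 T := ⟨h0, h.trans_lt ht.2⟩
        simp [hs1, hs2, h]
      · simp [indicator, h0]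
    · simp [indicator, h]
  have h2 : ∀ s ∈ Ioo 0 T, ∫ t, {p : ℝ × ℝ | p.2 ≤ p.1}.indicator
      (fun p => deriv η p.1 • g p.2) (t, s) ∂(timeMeasure T) = -(η s • g s) := by
    intro s hs
    have e : ∫ t in s..T, deriv η t = -η s := by
      rw [intervalIntegral.integral_deriv_eq_sub
        (fun t _ => hη1.differentiable (by simp) t) (hdc.intervalIntegrable _ _), hηT, zero_sub]
    rw [← neg_smul, ← e, intervalIntegral.integral_of_le hs.2.le, ← integral_Icc_eq_integral_Ioc,
      integral_Icc_eq_integral_Ico, ← integral_smul_const,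
      ← integral_indicator measurableSet_Ico, ← integral_indicator measurableSet_Ioo]
    congr 1 with t
    by_cases h : s ≤ t
    · by_cases h0 : t < T
      · have hs1 : t ∈ Ico s T := ⟨h, h0⟩
        have hs2 : t ∈ Ioo 0 T := ⟨hs.1.trans_le h, h0⟩
        simp [hs1, hs2, h]
      · simp [indicator, h0]
    · simp [indicator, h]
  rw [setIntegral_congr_fun measurableSet_Ioo h1, integral_integral_swap hint,
    setIntegral_congr_fun measurableSet_Ioo h2, integral_neg]

/-- The lemma of du Bois-Reymond: a function with an integrable weak derivative is a primitive of
this derivative. -/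
theorem HasWeakTimeDeriv.exists_ae_eq_primitive [CompleteSpace X] {T : ℝ} {f g : ℝ → X}
    (h : HasWeakTimeDeriv T f g) (hT : 0 < T) (hf : Integrable f (timeMeasure T))
    (hg : Integrable g (timeMeasure T)) :
    ∃ c, ∀ᵐ t ∂(timeMeasure T), f t = c + ∫ s in (0:ℝ)..t, g s := by
  obtain ⟨ψ₀, hψ₀, hψ₀1⟩ := exists_testFunction_integral_eq_one hT
  set w : ℝ → X := fun t => f t - ∫ s in (0:ℝ)..t, g s with hw
  have hprim : Integrable (fun t => ∫ s in (0:ℝ)..t, g s) (timeMeasure T) := by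
    have hc : ContinuousOn (fun t => ∫ s in (0:ℝ)..t, g s) (Icc 0 T) := by
      have := intervalIntegral.continuousOn_primitive_interval (μ := volume) (f := g)
        (a := 0) (b := T) (by
          rw [uIcc_of_le hT.le]
          exact (integrableOn_Icc_iff_integrableOn_Ioo).2 hg)
      rwa [uIcc_of_le hT.le] at this
    exact (hc.integrableOn_Icc).mono_set Ioo_subset_Icc_self
  have hwi : Integrable w (timeMeasure T) := hf.sub hprim
  have hsm : ∀ {ψ : ℝ → ℝ}, Continuous ψ → HasCompactSupport ψ → ∀ {k : ℝ → X},
      Integrable k (timeMeasure T) → Integrable (fun t => ψ t • k t) (timeMeasure T) := by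
    intro ψ hψc hψs k hk
    obtain ⟨C, hC⟩ := hψs.exists_bound_of_continuous hψc
    exact hk.bdd_smul C hψc.aestronglyMeasurable (Eventually.of_forall hC)
  have hzero : ∀ η, IsTestFunction (Ioo 0 T) η → ∫ t, deriv η t • w t ∂(timeMeasure T) = 0 := by
    intro η hη
    have hdc : Continuous (deriv η) := (hη.1.of_le (by simp) : ContDiff ℝ 1 η).continuous_deriv le_rfl
    simp only [hw, smul_sub]
    rw [integral_sub (hsm hdc hη.2.1.deriv hf) (hsm hdc hη.2.1.deriv hprim), h η hη,
      hη.integral_deriv_smul_primitive hg, sub_self]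
  set c : X := ∫ t, ψ₀ t • w t ∂(timeMeasure T) with hc
  refine ⟨c, ?_⟩
  have key : ∀ᵐ t, t ∈ Ioo 0 T → w t - c = 0 := by
    refine isOpen_Ioo.ae_eq_zero_of_integral_contDiff_smul_eq_zero ?_ ?_
    · have hi : IntegrableOn (fun t => w t - c) (Ioo 0 T) := hwi.sub (integrable_const c)
      exact hi.locallyIntegrableOn
    · intro ψ hψ1 hψ2 hψ3
      have hψ : IsTestFunction (Ioo 0 T) ψ := ⟨hψ1, hψ2, hψ3⟩
      have hi : ∀ {ψ : ℝ → ℝ}, IsTestFunction (Ioo 0 T) ψ → Integrable ψ := fun h =>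
        h.1.continuous.integrable_of_hasCompactSupport h.2.1
      -- Subtracting `(∫ ψ) ψ₀` gives mean zero, so the result is `η'` for a test function `η`, and
      -- `w` annihilates every such `η'`. Hence `w` pairs with `ψ` exactly as the constant `c` does.
      have hχ := hψ.linear_comb hψ₀ (-∫ t, ψ t)
      obtain ⟨η, hη, hηd⟩ := hχ.exists_deriv_eq hT (by
        rw [integral_add (hi hψ) ((hi hψ₀).const_mul _), integral_const_mul, hψ₀1]; ring)
      have hz := hzero η hη
      rw [hηd] at hz
      simp only [add_smul, mul_smul] at hz
      have hi₂ : Integrable (fun t => (-∫ t, ψ t) • ψ₀ t • w t) (timeMeasure T) :=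
        (hsm hψ₀.1.continuous hψ₀.2.1 hwi).smul _
      rw [integral_add (hsm hψ1.continuous hψ2 hwi) hi₂, integral_smul, ← hc] at hz
      have hr : ∫ t, ψ t • (w t - c) = ∫ t, ψ t • (w t - c) ∂(timeMeasure T) := by
        refine (setIntegral_eq_integral_of_forall_compl_eq_zero fun t ht => ?_).symm
        rw [image_eq_zero_of_notMem_tsupport fun h' => ht (hψ3 h'), zero_smul]
      have hr' : ∫ t, ψ t = ∫ t, ψ t ∂(timeMeasure T) := by
        refine (setIntegral_eq_integral_of_forall_compl_eq_zero fun t ht => ?_).symm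
        rw [image_eq_zero_of_notMem_tsupport fun h' => ht (hψ3 h')]
      rw [hr]
      simp only [smul_sub]
      rw [integral_sub (hsm hψ1.continuous hψ2 hwi)
        (hsm hψ1.continuous hψ2 (integrable_const c)), integral_smul_const, ← hr', sub_eq_add_neg,
        ← neg_smul, hz]
  rw [ae_restrict_iff' measurableSet_Ioo]
  filter_upwards [key] with t ht hmem
  have := ht hmem
  rw [hw] at this
  rw [← sub_eq_zero, ← this]
  simp only
  abel

end DuBoisReymond

/-! ### Correlations of square-integrable functions of time -/

section Translation

variable {Y : Type*} [NormedAddCommGroup Y] [NormedSpace ℝ Y]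

/-- The correlation of two `L²` functions on the line is continuous. -/
lemma continuous_integral_translate {g : ℝ → Y →L[ℝ] ℝ} {φ : ℝ → Y} (hg : MemLp g 2)
    (hφ : MemLp φ 2) : Continuous fun σ : ℝ => ∫ t, g (t - σ) (φ t) := by
  have hmp : ∀ σ : ℝ, MeasurePreserving (fun t : ℝ => t - σ) volume volume := fun σ =>
    measurePreserving_sub_right volume σ
  -- Translations form a continuous family of measure-preserving maps, so composing with them is
  -- continuous into `L²`; the correlation is then a duality pairing with one fixed factor.
  let G : C(ℝ, C(ℝ, ℝ)) := (ContinuousMap.mk (fun a : ℝ × ℝ => a.2 - a.1) (by fun_prop)).curry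
  have hc : Continuous fun σ => Lp.compMeasurePreserving (G σ) (hmp σ) (hg.toLp g) :=
    continuous_const.compMeasurePreservingLp G.continuous hmp (by simp)
  have hc2 : Continuous fun σ => ContinuousLinearMap.lpPairing volume 2 2
      (ContinuousLinearMap.id ℝ (Y →L[ℝ] ℝ))
      (Lp.compMeasurePreserving (G σ) (hmp σ) (hg.toLp g)) (hφ.toLp φ) :=
    ((ContinuousLinearMap.lpPairing volume 2 2 _).continuous.comp hc).clm_apply continuous_const
  refine hc2.congr fun σ => ?_
  rw [ContinuousLinearMap.lpPairing_eq_integral]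
  refine integral_congr_ae ?_
  filter_upwards [Lp.coeFn_compMeasurePreserving (hg.toLp g) (hmp σ), hφ.coeFn_toLp,
    (hmp σ).quasiMeasurePreserving.ae hg.coeFn_toLp] with t h1 h2 h3
  rw [h2]
  exact congrArg (fun l : Y →L[ℝ] ℝ => l (φ t)) (h1.trans h3)

/-- The integrand is dominated by `‖φ t‖² + ‖g (t - σ)‖²`. Translation invariance makes the
`t`-integral of the second term independent of `σ`, and `μ` is finite. This justifies Fubini in the
energy inequality. -/
lemma integrable_prod_translate {g : ℝ → Y →L[ℝ] ℝ} {φ : ℝ → Y} (hg : MemLp g 2)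
    (hφ : MemLp φ 2) {μ : Measure ℝ} [IsFiniteMeasure μ] (hμ : μ ≪ volume) :
    Integrable (Function.uncurry fun t σ : ℝ => g (t - σ) (φ t)) (volume.prod μ) := by
  have hqmp : Measure.QuasiMeasurePreserving (fun p : ℝ × ℝ => p.1 - p.2) (volume.prod μ)
      volume :=
    (quasiMeasurePreserving_sub volume volume).mono_left (Measure.AbsolutelyContinuous.rfl.prod hμ)
  have hgm : AEStronglyMeasurable (fun p : ℝ × ℝ => g (p.1 - p.2)) (volume.prod μ) :=
    hg.1.comp_quasiMeasurePreserving hqmp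
  have hφm : AEStronglyMeasurable (fun p : ℝ × ℝ => φ p.1) (volume.prod μ) := hφ.1.comp_fst
  have hg2 : Integrable (fun t => ‖g t‖ ^ 2) := hg.integrable_norm_pow (by simp)
  have hφ2 : Integrable (fun t => ‖φ t‖ ^ 2) := hφ.integrable_norm_pow (by simp)
  have i1 : Integrable (fun p : ℝ × ℝ => ‖φ p.1‖ ^ 2) (volume.prod μ) := hφ2.comp_fst μ
  have i2 : Integrable (fun p : ℝ × ℝ => ‖g (p.1 - p.2)‖ ^ 2) (volume.prod μ) := by
    refine (integrable_prod_iff' (f := fun p : ℝ × ℝ => ‖g (p.1 - p.2)‖ ^ 2)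
      (hgm.norm.pow 2)).2 ?_
    refine ⟨Eventually.of_forall fun σ => hg2.comp_sub_right σ, ?_⟩
    have : (fun σ : ℝ => ∫ t, ‖‖g (t - σ)‖ ^ 2‖) = fun _ => ∫ t, ‖‖g t‖ ^ 2‖ :=
      funext fun σ => integral_sub_right_eq_self (fun t => ‖‖g t‖ ^ 2‖) σ
    simp only [this]
    exact integrable_const _
  refine (i1.add i2).mono' ?_ (Eventually.of_forall fun p => ?_)
  · exact isBoundedBilinearMap_apply.continuous.comp_aestronglyMeasurable (hgm.prodMk hφm)
  · refine ((g (p.1 - p.2)).le_opNorm (φ p.1)).trans ?_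
    simp only [Pi.add_apply]
    nlinarith [sq_nonneg (‖g (p.1 - p.2)‖ - ‖φ p.1‖), sq_nonneg ‖g (p.1 - p.2)‖,
      sq_nonneg ‖φ p.1‖]

end Translation

/-! ### Essential limits at the initial time and Gronwall's inequality -/

lemma nhdsGT_inf_ae_neBot (a : ℝ) : (𝓝[>] a ⊓ ae (volume : Measure ℝ)).NeBot := by
  rw [Filter.inf_neBot_iff]
  intro s hs t ht
  obtain ⟨b, hb, hbs⟩ := (mem_nhdsGT_iff_exists_Ioo_subset).1 hs
  by_contra h
  have hsub : Ioo a b ⊆ tᶜ := fun x hx hxt => h ⟨x, hbs hx, hxt⟩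
  have h0 : volume (Ioo a b) = 0 := measure_mono_null hsub (mem_ae_iff.1 ht)
  rw [Real.volume_Ioo, ENNReal.ofReal_eq_zero] at h0
  have : a < b := hb
  linarith

/-- A nonnegative function bounded by a multiple of its primitive vanishes. -/
lemma ae_eq_zero_of_le_mul_primitive {T C : ℝ} (hT : 0 < T) {E : ℝ → ℝ}
    (hE : Integrable E (timeMeasure T)) (h0 : ∀ t, 0 ≤ E t)
    (hle : ∀ᵐ s ∂(timeMeasure T), E s ≤ C * ∫ t in (0:ℝ)..s, E t) :
    ∀ᵐ s ∂(timeMeasure T), E s = 0 := by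
  have hEi : IntegrableOn E (uIcc 0 T) := by
    rw [uIcc_of_le hT.le]
    exact (integrableOn_Icc_iff_integrableOn_Ioo).2 hE
  set Y : ℝ → ℝ := fun s => ∫ t in (0:ℝ)..s, E t with hY
  have hYc : ContinuousOn Y (Icc 0 T) := by
    have := intervalIntegral.continuousOn_primitive_interval (μ := volume) hEi
    rwa [uIcc_of_le hT.le] at this
  have hY0 : ∀ s, 0 ≤ s → 0 ≤ Y s := fun s hs =>
    intervalIntegral.integral_nonneg hs fun t _ => h0 t
  -- Since `E` is merely integrable, its primitive `Y` need not be differentiable everywhere.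
  -- Integrating once more gives a `Z` with right derivative `Y ≤ C Z` at every point of `[0, T)`,
  -- to which the classical Gronwall lemma applies.
  set Z : ℝ → ℝ := fun s => ∫ t in (0:ℝ)..s, Y t with hZ
  have hYi : ∀ s ∈ Icc 0 T, IntervalIntegrable Y volume 0 s := fun s hs =>
    (hYc.mono (by rw [uIcc_of_le hs.1]; exact Icc_subset_Icc_right hs.2)).intervalIntegrable
  have hZc : ContinuousOn Z (Icc 0 T) := by
    have := intervalIntegral.continuousOn_primitive_interval (μ := volume) (a := 0) (b := T)
      (f := Y) (by rw [uIcc_of_le hT.le]; exact hYc.integrableOn_Icc)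
    rwa [uIcc_of_le hT.le] at this
  have hZ0 : ∀ s, 0 ≤ s → 0 ≤ Z s := fun s hs =>
    intervalIntegral.integral_nonneg hs fun t ht => hY0 t ht.1
  have hYZ : ∀ s ∈ Ico 0 T, Y s ≤ C * Z s := by
    intro s hs
    rw [hY, hZ]
    simp only
    rw [← intervalIntegral.integral_const_mul]
    refine intervalIntegral.integral_mono_ae_restrict hs.1 ?_
      ((hYi s ⟨hs.1, hs.2.le⟩).const_mul C) ?_
    · refine (hEi.mono_set ?_).intervalIntegrable
      rw [uIcc_of_le hT.le, uIcc_of_le hs.1]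
      exact Icc_subset_Icc_right hs.2.le
    · rw [← restrict_Ioo_eq_restrict_Icc]
      exact ae_restrict_of_ae_restrict_of_subset (Ioo_subset_Ioo_right hs.2.le) hle
  have hder : ∀ s ∈ Ico 0 T, HasDerivWithinAt Z (Y s) (Ici s) s := by
    intro s hs
    have hmem : Icc 0 T ∈ 𝓝[Ici s] s :=
      mem_of_superset (Icc_mem_nhdsGE hs.2) (Icc_subset_Icc_left hs.1)
    have hmem' : Icc 0 T ∈ 𝓝[>] s := nhdsWithin_mono _ Ioi_subset_Ici_self hmem
    refine intervalIntegral.integral_hasDerivWithinAt_right (hYi s ⟨hs.1, hs.2.le⟩)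
      (t := Ioi s) ?_ ?_
    · exact ⟨Icc 0 T, hmem', hYc.aestronglyMeasurable measurableSet_Icc⟩
    · exact (hYc s ⟨hs.1, hs.2.le⟩).mono_of_mem_nhdsWithin hmem'
  have hgr := norm_le_gronwallBound_of_norm_deriv_right_le (δ := 0) (K := C) (ε := 0) hZc hder
    (by simp [hZ]) (by
      intro s hs
      rw [Real.norm_of_nonneg (hY0 s hs.1), Real.norm_of_nonneg (hZ0 s hs.1), add_zero]
      exact hYZ s hs)
  have hZz : ∀ s ∈ Ico 0 T, Z s = 0 := by
    intro s hs
    have := hgr s ⟨hs.1, hs.2.le⟩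
    rw [gronwallBound_ε0, zero_mul] at this
    exact norm_le_zero_iff.1 this
  rw [ae_restrict_iff' measurableSet_Ioo] at hle ⊢
  filter_upwards [hle] with s hs hmem
  have h1 := hYZ s ⟨hmem.1.le, hmem.2⟩
  rw [hZz s ⟨hmem.1.le, hmem.2⟩, mul_zero] at h1
  have h2 : Y s = 0 := le_antisymm h1 (hY0 s hmem.1.le)
  have h3 := hs hmem
  rw [show (∫ t in (0:ℝ)..s, E t) = 0 from h2, mul_zero] at h3
  exact le_antisymm h3 (h0 s)

/-- An `L²` function on a measurable set extends by zero. -/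
lemma exists_memLp_extension {X : Type*} [NormedAddCommGroup X] {s : Set ℝ}
    (hs : MeasurableSet s) {f : ℝ → X} (hf : MemLp f 2 (volume.restrict s)) :
    ∃ g : ℝ → X, MemLp g 2 volume ∧ (∀ t ∈ s, g t = f t) ∧ ∀ t ∉ s, g t = 0 :=
  ⟨s.indicator f, (memLp_indicator_iff_restrict hs).2 hf, fun _ ht => indicator_of_mem ht f,
    fun _ ht => indicator_of_notMem ht f⟩

/-! ### The energy inequality for convex functionals -/

section Energy

variable {H Y : Type*} [NormedAddCommGroup H] [InnerProductSpace ℝ H]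
  [NormedAddCommGroup Y] [NormedSpace ℝ Y]

/-- Integrated form of the inequality `f' ≤ ⟨U', φ⟩` on intervals whose end points are Lebesgue
points of `f`. -/
lemma sub_le_integral_of_sub_le_primitive {T : ℝ} {W : ℝ → Y →L[ℝ] ℝ}
    {U' : ℝ → Y →L[ℝ] ℝ} {φ : ℝ → Y} {f : ℝ → ℝ}
    (hU' : MemLp U' 2 (timeMeasure T)) (hφ : MemLp φ 2 (timeMeasure T))
    (hf : Integrable f (timeMeasure T)) {c : Y →L[ℝ] ℝ}
    (hW : ∀ᵐ t ∂(timeMeasure T), W t = c + ∫ s in (0:ℝ)..t, U' s)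
    (hsub : ∀ s t, f t - f s ≤ (W t - W s) (φ t)) :
    ∃ S : Set ℝ, (∀ᵐ t ∂(timeMeasure T), t ∈ S) ∧ ∀ a ∈ S, ∀ b ∈ S, 0 < a → a ≤ b → b < T →
      f b - f a ≤ ∫ t in a..b, U' t (φ t) := by
  set fe : ℝ → ℝ := (Ioo 0 T).indicator f with hfe
  have hfei : Integrable fe := (integrable_indicator_iff measurableSet_Ioo).2 hf
  obtain ⟨ge, hgeL, hge, -⟩ := exists_memLp_extension measurableSet_Ioo hU'
  set P : ℝ → ℝ := fun x => ∫ t in (0:ℝ)..x, fe t with hP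
  have hLeb : ∀ᵐ x, HasDerivAt P (fe x) x :=
    (LocallyIntegrable.ae_hasDerivAt_integral hfei.locallyIntegrable).mono fun x hx => hx 0
  obtain ⟨S, hS, hSd⟩ : ∃ S : Set ℝ, (∀ᵐ t, t ∈ S) ∧ ∀ x ∈ S, HasDerivAt P (fe x) x :=
    ⟨{x | HasDerivAt P (fe x) x}, hLeb, fun _ h => h⟩
  refine ⟨S, ae_restrict_of_ae hS, fun a haS b hbS ha hab hb => ?_⟩
  have hSa := hSd a haS
  have hSb := hSd b hbS
  have hsubab : Ioc a b ⊆ Ioo 0 T := fun t ht => ⟨ha.trans ht.1, ht.2.trans_lt hb⟩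
  -- Extending `φ` by zero from `(a, b]`, not from `(0, T)`, turns the integral over `(a, b]` into a
  -- correlation on the whole line, whose continuity at `σ = 0` is known.
  obtain ⟨φe, hφeL, hφe, hφe0⟩ := exists_memLp_extension (f := φ) measurableSet_Ioc
    (hφ.mono_measure (Measure.restrict_mono hsubab le_rfl))
  have hGc := continuous_integral_translate hgeL hφeL
  set G : ℝ → ℝ := fun σ => ∫ t, ge (t - σ) (φe t) with hG
  have hG0 : G 0 = ∫ t in a..b, U' t (φ t) := by
    rw [intervalIntegral.integral_of_le hab, ← integral_indicator measurableSet_Ioc]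
    simp only [hG, sub_zero]
    congr 1 with t
    by_cases ht : t ∈ Ioc a b
    · simp [hge t (hsubab ht), hφe t ht, ht]
    · simp [hφe0 t ht, ht]
  have hU'i : Integrable U' (timeMeasure T) := hU'.integrable (by norm_num)
  -- the inequality at times `t - h` and `t`
  have hstep : ∀ h ∈ Ioo 0 a, (P b - P a) - (P (b - h) - P (a - h)) ≤ ∫ σ in (0:ℝ)..h, G σ := by
    intro h hh
    have hWe : ∀ᵐ t, t ∈ Ioo 0 T → W t = c + ∫ s in (0:ℝ)..t, U' s :=
      (ae_restrict_iff' measurableSet_Ioo).1 hW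
    have hWe' : ∀ᵐ t, t - h ∈ Ioo 0 T → W (t - h) = c + ∫ s in (0:ℝ)..(t - h), U' s :=
      (measurePreserving_sub_right volume h).quasiMeasurePreserving.ae hWe
    have hiI := integrable_prod_translate hgeL hφeL (μ := volume.restrict (Ioc 0 h))
      Measure.restrict_le_self.absolutelyContinuous
    have hpt : ∀ᵐ t ∂(volume.restrict (Ioc a b)),
        fe t - fe (t - h) ≤ ∫ σ in Ioc 0 h, ge (t - σ) (φe t) := by
      refine (ae_restrict_iff' measurableSet_Ioc).2 ?_
      filter_upwards [hWe, hWe'] with t h1 h2 ht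
      have m1 : t ∈ Ioo 0 T := hsubab ht
      have m2 : t - h ∈ Ioo 0 T := ⟨by linarith [hh.2, ht.1], by linarith [hh.1, m1.2]⟩
      have hii : ∀ x y, x ∈ Ioo 0 T → y ∈ Ioo 0 T → IntervalIntegrable U' volume x y :=
        fun x y hx hy => by
          refine IntegrableOn.intervalIntegrable (IntegrableOn.mono_set (t := Ioo 0 T) hU'i ?_)
          exact (Set.ordConnected_Ioo).uIcc_subset hx hy
      have hii0 : ∀ x, x ∈ Ioo 0 T → IntervalIntegrable U' volume 0 x := fun x hx => by
        rw [intervalIntegrable_iff, uIoc_of_le hx.1.le]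
        exact IntegrableOn.mono_set (t := Ioo 0 T) hU'i fun z hz => ⟨hz.1, hz.2.trans_lt hx.2⟩
      have e1 : W t - W (t - h) = ∫ s in (t - h)..t, U' s := by
        rw [h1 m1, h2 m2, ← intervalIntegral.integral_interval_sub_left (hii0 t m1) (hii0 _ m2)]
        abel
      have e2 : ∫ σ in Ioc 0 h, ge (t - σ) (φe t) = (W t - W (t - h)) (φ t) := by
        rw [e1, ContinuousLinearMap.intervalIntegral_apply (hii _ _ m2 m1),
          ← intervalIntegral.integral_of_le hh.1.le,
          intervalIntegral.integral_comp_sub_left (fun s => ge s (φe t)) t, sub_zero]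
        refine intervalIntegral.integral_congr fun s hs => ?_
        have hs' : s ∈ Ioo 0 T := (Set.ordConnected_Ioo).uIcc_subset m2 m1 hs
        simp [hge s hs', hφe t ht]
      rw [e2, hfe, indicator_of_mem m1, indicator_of_mem m2]
      exact hsub _ _
    have hshift : Integrable fun t => fe (t - h) := hfei.comp_sub_right h
    have hint := integral_mono_ae (hfei.sub hshift).restrict
      (hiI.integral_prod_left.restrict (s := Ioc a b)) hpt
    have eR : ∫ t in Ioc a b, ∫ σ in Ioc 0 h, ge (t - σ) (φe t) = ∫ σ in (0:ℝ)..h, G σ := by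
      rw [intervalIntegral.integral_of_le hh.1.le, setIntegral_eq_integral_of_forall_compl_eq_zero,
        integral_integral_swap hiI]
      intro t ht
      simp [hφe0 t ht]
    have hfi : ∀ x y, IntervalIntegrable fe volume x y := fun x y => hfei.intervalIntegrable
    have eL : ∫ t in Ioc a b, (fe - fun t => fe (t - h)) t
        = (P b - P a) - (P (b - h) - P (a - h)) := by
      simp only [Pi.sub_apply, hP]
      rw [integral_sub hfei.restrict hshift.restrict, ← intervalIntegral.integral_of_le hab,
        ← intervalIntegral.integral_of_le hab, intervalIntegral.integral_comp_sub_right,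
        intervalIntegral.integral_interval_sub_left (hfi _ _) (hfi _ _),
        intervalIntegral.integral_interval_sub_left (hfi _ _) (hfi _ _)]
    rw [← eL, ← eR]
    exact hint
  -- division by `h → 0`
  set R : ℝ → ℝ := fun h => (∫ σ in (0:ℝ)..h, G σ)
    - ((P b - P a) - (P (b - h) - P (a - h))) with hR
  have hd1 : HasDerivAt (fun h => ∫ σ in (0:ℝ)..h, G σ) (G 0) 0 :=
    (hGc.integral_hasStrictDerivAt 0 0).hasDerivAt
  have hd2 : ∀ x, HasDerivAt P (fe x) x → HasDerivAt (fun h => P (x - h)) (-fe x) 0 := by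
    intro x hx
    have hx' : HasDerivAt P (fe x) (x - 0) := by rwa [sub_zero]
    exact hx'.comp_const_sub x 0
  have hd : HasDerivAt R (G 0 - (0 - (-fe b - -fe a))) 0 :=
    hd1.sub ((hasDerivAt_const 0 (P b - P a)).sub ((hd2 b hSb).sub (hd2 a hSa)))
  have hlim := hd.tendsto_slope_zero_right
  -- `R` vanishes at `0` and is nonnegative on `(0, a)`, so its derivative `G 0 - (f b - f a)` at
  -- `0` is nonnegative.
  have hnn : 0 ≤ G 0 - (0 - (-fe b - -fe a)) := by
    refine ge_of_tendsto hlim ?_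
    filter_upwards [Ioo_mem_nhdsGT ha] with h hh
    have hR0 : R 0 = 0 := by simp [hR]
    rw [zero_add, hR0, sub_zero, smul_eq_mul]
    exact mul_nonneg (inv_nonneg.2 hh.1.le) (sub_nonneg.2 (hstep h hh))
  have ea : fe a = f a := indicator_of_mem (show a ∈ Ioo 0 T from ⟨ha, hab.trans_lt hb⟩) f
  have eb : fe b = f b := indicator_of_mem (show b ∈ Ioo 0 T from ⟨ha.trans_le hab, hb⟩) f
  rw [← hG0]
  rw [ea, eb] at hnn
  linarith

/-- The energy inequality: if `φ` is a subgradient of a convex function `j` along `U`, and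
`f = j ∘ U` vanishes at time `0`, then `f(s) ≤ ∫₀ˢ ⟨U', φ⟩`. -/
theorem HasWeakTimeDeriv.energy_le {T : ℝ} (hT : 0 < T) (i : Y →L[ℝ] H) {U : ℝ → H}
    {U' : ℝ → Y →L[ℝ] ℝ} {φ : ℝ → Y} {f : ℝ → ℝ}
    (hU : MemLp U 2 (timeMeasure T)) (hU' : MemLp U' 2 (timeMeasure T))
    (hφ : MemLp φ 2 (timeMeasure T))
    (hweak : HasWeakTimeDeriv T (fun t => (innerSL ℝ (U t)).comp i) U')
    (hf : Integrable f (timeMeasure T))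
    (hsub : ∀ s t, f t - f s ≤ ⟪U t - U s, i (φ t)⟫)
    (h0 : Tendsto f (𝓝[>] 0 ⊓ ae volume) (𝓝 0)) :
    ∀ᵐ s ∂(timeMeasure T), f s ≤ ∫ t in (0:ℝ)..s, U' t (φ t) := by
  have hWL : Integrable (fun t => (innerSL ℝ (U t)).comp i) (timeMeasure T) :=
    ((((ContinuousLinearMap.compL ℝ Y H ℝ).flip i).comp (innerSL ℝ)).integrable_comp
      (hU.integrable (by norm_num)))
  obtain ⟨c, hc⟩ := hweak.exists_ae_eq_primitive hT hWL (hU'.integrable (by norm_num))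
  obtain ⟨S, hS, hle⟩ := sub_le_integral_of_sub_le_primitive hU' hφ hf hc
    (fun s t => (hsub s t).trans_eq (by simp [inner_sub_left]))
  have hq : Integrable (fun t => U' t (φ t)) (timeMeasure T) := by
    have h2 := hU'.integrable_norm_pow (p := 2) (by simp)
    have h3 := hφ.integrable_norm_pow (p := 2) (by simp)
    refine (h2.add h3).mono' ?_ (Eventually.of_forall fun t => ?_)
    · exact isBoundedBilinearMap_apply.continuous.comp_aestronglyMeasurable (hU'.1.prodMk hφ.1)
    · refine ((U' t).le_opNorm (φ t)).trans ?_
      simp only [Pi.add_apply]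
      nlinarith [sq_nonneg (‖U' t‖ - ‖φ t‖), sq_nonneg ‖U' t‖, sq_nonneg ‖φ t‖]
  have hQc : ContinuousOn (fun s => ∫ t in (0:ℝ)..s, U' t (φ t)) (Icc 0 T) := by
    have := intervalIntegral.continuousOn_primitive_interval (μ := volume) (a := 0) (b := T)
      (f := fun t => U' t (φ t)) (by
        rw [uIcc_of_le hT.le]
        exact (integrableOn_Icc_iff_integrableOn_Ioo).2 hq)
    rwa [uIcc_of_le hT.le] at this
  have hii : ∀ x ∈ Ioo 0 T, IntervalIntegrable (fun t => U' t (φ t)) volume 0 x := by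
    intro x hx
    rw [intervalIntegrable_iff, uIoc_of_le hx.1.le]
    exact IntegrableOn.mono_set (t := Ioo 0 T) hq fun z hz => ⟨hz.1, hz.2.trans_lt hx.2⟩
  have hS' := (ae_restrict_iff' measurableSet_Ioo).1 hS
  rw [ae_restrict_iff' measurableSet_Ioo]
  filter_upwards [hS'] with s hs hmem
  have := nhdsGT_inf_ae_neBot 0
  have hlim0 : Tendsto (fun a => ∫ t in (0:ℝ)..a, U' t (φ t)) (𝓝[>] 0 ⊓ ae volume) (𝓝 0) := by
    have h1 := hQc 0 ⟨le_rfl, hT.le⟩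
    have h2 : ContinuousWithinAt (fun s => ∫ t in (0:ℝ)..s, U' t (φ t)) (Ioi 0) 0 :=
      h1.mono_of_mem_nhdsWithin (mem_of_superset (Ioo_mem_nhdsGT hT) Ioo_subset_Icc_self)
    have h3 := h2.tendsto
    simp only [intervalIntegral.integral_same] at h3
    exact h3.mono_left inf_le_left
  -- The left end point `a` tends to `0` within the full-measure set `S`; the initial condition
  -- removes `f a`.
  have hlim : Tendsto (fun a => f a + ((∫ t in (0:ℝ)..s, U' t (φ t))
      - ∫ t in (0:ℝ)..a, U' t (φ t))) (𝓝[>] 0 ⊓ ae volume)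
      (𝓝 (0 + ((∫ t in (0:ℝ)..s, U' t (φ t)) - 0))) :=
    h0.add (tendsto_const_nhds.sub hlim0)
  rw [zero_add, sub_zero] at hlim
  refine ge_of_tendsto hlim ?_
  have hev1 : ∀ᶠ a in 𝓝[>] 0 ⊓ ae volume, a ∈ Ioo 0 s :=
    Filter.Eventually.filter_mono inf_le_left (Ioo_mem_nhdsGT hmem.1)
  have hev2 : ∀ᶠ a in 𝓝[>] (0:ℝ) ⊓ ae volume, a ∈ Ioo 0 T → a ∈ S :=
    Filter.Eventually.filter_mono inf_le_right hS'
  filter_upwards [hev1, hev2] with a ha haS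
  have ham : a ∈ Ioo 0 T := ⟨ha.1, ha.2.trans hmem.2⟩
  have := hle a (haS ham) s (hs hmem) ha.1 ha.2.le hmem.2
  rw [intervalIntegral.integral_interval_sub_left (hii s hmem) (hii a ham)]
  linarith

end Energy

/-! ### Composition of Sobolev pairs with truncations -/

/-- Dominated convergence in `L²`. -/
lemma tendsto_L2_of_dominated {α E F : Type*} [MeasurableSpace α] {μ : Measure α}
    [NormedAddCommGroup E] [NormedAddCommGroup F] {f : ℕ → Lp E 2 μ} {f₀ : Lp E 2 μ}
    (g : Lp F 2 μ) (hb : ∀ n, ∀ᵐ x ∂μ, ‖f n x‖ ≤ ‖g x‖)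
    (hlim : ∀ᵐ x ∂μ, Tendsto (fun n => f n x) atTop (𝓝 (f₀ x))) :
    Tendsto f atTop (𝓝 f₀) := by
  have hb₀ : ∀ᵐ x ∂μ, ‖f₀ x‖ ≤ ‖g x‖ := by
    filter_upwards [ae_all_iff.2 hb, hlim] with x h1 h2
    exact le_of_tendsto h2.norm (Eventually.of_forall h1)
  rw [Lp.tendsto_Lp_iff_tendsto_eLpNorm']
  have h2 : ∀ h : α → E, eLpNorm h 2 μ = (∫⁻ x, ‖h x‖ₑ ^ (2:ℝ) ∂μ) ^ (1 / (2:ℝ)) := fun h => by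
    rw [eLpNorm_eq_lintegral_rpow_enorm_toReal (by simp) (by simp)]
    simp
  simp only [h2]
  have hl : Tendsto (fun n => ∫⁻ x, ‖(⇑(f n) - ⇑f₀) x‖ₑ ^ (2:ℝ) ∂μ) atTop (𝓝 0) := by
    rw [← lintegral_zero (μ := μ)]
    refine tendsto_lintegral_of_dominated_convergence' (fun x => (2 * ‖g x‖ₑ) ^ (2:ℝ)) ?_ ?_ ?_ ?_
    · intro n
      exact ((Lp.aestronglyMeasurable (f n)).sub
        (Lp.aestronglyMeasurable f₀)).enorm.pow_const _
    · intro n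
      filter_upwards [hb n, hb₀] with x h1 h3
      refine ENNReal.rpow_le_rpow ?_ (by norm_num)
      rw [two_mul]
      refine (enorm_sub_le).trans (add_le_add ?_ ?_)
      · exact enorm_le_iff_norm_le.2 h1
      · exact enorm_le_iff_norm_le.2 h3
    · simp only [ENNReal.mul_rpow_of_nonneg _ _ (show (0:ℝ) ≤ 2 by norm_num)]
      rw [lintegral_const_mul' _ _ (by simp)]
      refine ENNReal.mul_ne_top (by simp) ?_
      have := (lintegral_rpow_enorm_lt_top_of_eLpNorm_lt_top (p := 2) (by simp) (by simp)
        (Lp.eLpNorm_lt_top g))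
      simpa using this.ne
    · filter_upwards [hlim] with x hx
      have h3 : Tendsto (fun n => (f n x - f₀ x)) atTop (𝓝 0) := by
        simpa using hx.sub_const (f₀ x)
      have h4 := (h3.enorm).ennrpow_const 2
      simpa using h4
  have := hl.ennrpow_const (1 / (2:ℝ))
  simpa using this

section Chain

variable {d : ℕ} {Ω : Set (Euc d)}

lemma L2Pair.memLp_mul_snd {b : ℝ → ℝ} (hb : Measurable b) {C : ℝ} (hC : ∀ s, |b s| ≤ C)
    (p : L2Pair Ω) : MemLp (fun x => b (p.fst x) • p.snd x) 2 (volume.restrict Ω) := by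
  have hm : AEStronglyMeasurable (fun x => b (p.fst x)) (volume.restrict Ω) :=
    (hb.comp_aemeasurable (Lp.aestronglyMeasurable p.fst).aemeasurable).aestronglyMeasurable
  refine ((Lp.memLp p.snd).const_smul C).mono (hm.smul (Lp.aestronglyMeasurable p.snd)) ?_
  refine Eventually.of_forall fun x => ?_
  simp only [Pi.smul_apply, norm_smul, Real.norm_eq_abs]
  exact mul_le_mul_of_nonneg_right ((hC _).trans (le_abs_self C)) (norm_nonneg _)

/-- The `L²` vector field `b(f) G` for `(f, G) ∈ L² × L²`. -/
noncomputable def L2Pair.mulSnd {b : ℝ → ℝ} (hb : Measurable b) {C : ℝ} (hC : ∀ s, |b s| ≤ C)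
    (p : L2Pair Ω) : L2Vec Ω :=
  (L2Pair.memLp_mul_snd hb hC p).toLp _

lemma L2Pair.coeFn_mulSnd {b : ℝ → ℝ} (hb : Measurable b) {C : ℝ} (hC : ∀ s, |b s| ≤ C)
    (p : L2Pair Ω) :
    L2Pair.mulSnd hb hC p =ᵐ[volume.restrict Ω] fun x => b (p.fst x) • p.snd x :=
  (L2Pair.memLp_mul_snd hb hC p).coeFn_toLp

/-- Split `b(fₙ)Gₙ = b(fₙ)(Gₙ - G) + b(fₙ)G`. The first term is small because `b` is bounded; the
second converges by domination along a subsequence on which `fₙ → f` almost everywhere, and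
subsequences suffice. -/
lemma L2Pair.continuous_mulSnd {b : ℝ → ℝ} (hb : Continuous b) {C : ℝ} (hC : ∀ s, |b s| ≤ C) :
    Continuous (L2Pair.mulSnd hb.measurable hC : L2Pair Ω → L2Vec Ω) := by
  refine continuous_iff_seqContinuous.2 fun p p₀ hp => ?_
  have hfst : Tendsto (fun n => (p n).fst) atTop (𝓝 p₀.fst) :=
    ((WithLp.fstL 2 ℝ (L2 Ω) (L2Vec Ω)).continuous.tendsto p₀).comp hp
  have hsnd : Tendsto (fun n => (p n).snd) atTop (𝓝 p₀.snd) :=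
    ((WithLp.sndL 2 ℝ (L2 Ω) (L2Vec Ω)).continuous.tendsto p₀).comp hp
  refine tendsto_of_subseq_tendsto fun ns hns => ?_
  obtain ⟨ms, hms, hae⟩ :=
    (tendstoInMeasure_of_tendsto_Lp (hfst.comp hns)).exists_seq_tendsto_ae
  refine ⟨ms, ?_⟩
  set q : ℕ → L2Pair Ω := fun n => p (ns (ms n)) with hq
  set r : ℕ → L2Pair Ω := fun n => WithLp.toLp 2 ((q n).fst, p₀.snd) with hr
  have hr1 : Tendsto (fun n => L2Pair.mulSnd hb.measurable hC (r n)) atTop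
      (𝓝 (L2Pair.mulSnd hb.measurable hC p₀)) := by
    refine tendsto_L2_of_dominated (C • p₀.snd) (fun n => ?_) ?_
    · filter_upwards [L2Pair.coeFn_mulSnd hb.measurable hC (r n), Lp.coeFn_smul C p₀.snd]
        with x h1 h2
      rw [h1, h2, Pi.smul_apply, norm_smul, norm_smul]
      exact mul_le_mul_of_nonneg_right ((hC _).trans (le_abs_self C)) (norm_nonneg _)
    · filter_upwards [ae_all_iff.2 fun n => L2Pair.coeFn_mulSnd hb.measurable hC (r n),
        L2Pair.coeFn_mulSnd hb.measurable hC p₀, hae] with x h1 h2 h3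
      simp only [h1, h2]
      exact ((hb.tendsto _).comp h3).smul_const _
  have hr2 : Tendsto (fun n => L2Pair.mulSnd hb.measurable hC (q n)
      - L2Pair.mulSnd hb.measurable hC (r n)) atTop (𝓝 0) := by
    have hz : Tendsto (fun n => C * ‖(q n).snd - p₀.snd‖) atTop (𝓝 0) := by
      have := ((hsnd.comp hns).comp hms.tendsto_atTop).sub_const p₀.snd
      simpa using this.norm.const_mul C
    refine squeeze_zero_norm (fun n => ?_) hz
    refine Lp.norm_le_mul_norm_of_ae_le_mul ?_
    filter_upwards [L2Pair.coeFn_mulSnd hb.measurable hC (r n),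
      L2Pair.coeFn_mulSnd hb.measurable hC (q n), Lp.coeFn_sub (q n).snd p₀.snd,
      Lp.coeFn_sub (L2Pair.mulSnd hb.measurable hC (q n))
        (L2Pair.mulSnd hb.measurable hC (r n))] with x h1 h2 h3 h4
    rw [h3, h4, Pi.sub_apply, Pi.sub_apply, h1, h2]
    have : b ((q n).fst x) • (q n).snd x - b ((r n).fst x) • (r n).snd x
        = b ((q n).fst x) • ((q n).snd x - p₀.snd x) := by
      rw [smul_sub]
      rfl
    rw [this, norm_smul]
    exact mul_le_mul_of_nonneg_right (hC _) (norm_nonneg _)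
  have := hr2.add hr1
  simpa using this

/-- A nonexpansive function `β` with `β 0 = 0`, together with a function `β'` playing the role of
its derivative. -/
structure IsTruncation (β β' : ℝ → ℝ) : Prop where
  lipschitz : LipschitzWith 1 β
  map_zero : β 0 = 0
  measurable : Measurable β'
  bound : ∀ s, |β' s| ≤ 1

/-- The pair `(β(f), β'(f) G)`. -/
noncomputable def L2Pair.chain {β β' : ℝ → ℝ} (h : IsTruncation β β') (p : L2Pair Ω) : L2Pair Ω :=
  WithLp.toLp 2 (h.lipschitz.compLp h.map_zero p.fst, L2Pair.mulSnd h.measurable h.bound p)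

lemma L2Pair.coeFn_chain_fst {β β' : ℝ → ℝ} (h : IsTruncation β β') (p : L2Pair Ω) :
    (L2Pair.chain h p).fst =ᵐ[volume.restrict Ω] fun x => β (p.fst x) :=
  h.lipschitz.coeFn_compLp h.map_zero p.fst

lemma L2Pair.coeFn_chain_snd {β β' : ℝ → ℝ} (h : IsTruncation β β') (p : L2Pair Ω) :
    (L2Pair.chain h p).snd =ᵐ[volume.restrict Ω] fun x => β' (p.fst x) • p.snd x :=
  L2Pair.coeFn_mulSnd h.measurable h.bound p

lemma IsTruncation.norm_le {β β' : ℝ → ℝ} (h : IsTruncation β β') (s : ℝ) : ‖β s‖ ≤ ‖s‖ := by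
  have := h.lipschitz.norm_sub_le s 0
  simpa [h.map_zero] using this

lemma L2Pair.norm_chain_le {β β' : ℝ → ℝ} (h : IsTruncation β β') (p : L2Pair Ω) :
    ‖L2Pair.chain h p‖ ≤ ‖p‖ := by
  have h1 : ‖(L2Pair.chain h p).fst‖ ≤ ‖p.fst‖ := by
    refine Lp.norm_le_norm_of_ae_le ?_
    filter_upwards [L2Pair.coeFn_chain_fst h p] with x hx
    rw [hx]
    exact h.norm_le _
  have h2 : ‖(L2Pair.chain h p).snd‖ ≤ ‖p.snd‖ := by
    refine Lp.norm_le_norm_of_ae_le ?_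
    filter_upwards [L2Pair.coeFn_chain_snd h p] with x hx
    rw [hx, norm_smul]
    exact mul_le_of_le_one_left (norm_nonneg _) (h.bound _)
  refine le_of_sq_le_sq ?_ (norm_nonneg _)
  rw [WithLp.prod_norm_sq_eq_of_L2, WithLp.prod_norm_sq_eq_of_L2]
  gcongr

lemma L2Pair.continuous_chain {β β' : ℝ → ℝ} (h : IsTruncation β β') (hc : Continuous β') :
    Continuous (L2Pair.chain h : L2Pair Ω → L2Pair Ω) := by
  refine (WithLp.prod_continuous_toLp 2 _ _).comp (Continuous.prodMk ?_ ?_)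
  · exact (h.lipschitz.continuous_compLp h.map_zero).comp
      (WithLp.fstL 2 ℝ (L2 Ω) (L2Vec Ω)).continuous
  · exact L2Pair.continuous_mulSnd hc h.bound

/-- Both components are dominated by `|f|` and `|G|`, so pointwise convergence is enough. The limit
`β₀'` may therefore jump, as it does for the positive part. -/
lemma L2Pair.tendsto_chain {β β' : ℕ → ℝ → ℝ} {β₀ β₀' : ℝ → ℝ}
    (h : ∀ n, IsTruncation (β n) (β' n)) (h₀ : IsTruncation β₀ β₀')
    (hβ : ∀ s, Tendsto (fun n => β n s) atTop (𝓝 (β₀ s)))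
    (hβ' : ∀ s, Tendsto (fun n => β' n s) atTop (𝓝 (β₀' s))) (p : L2Pair Ω) :
    Tendsto (fun n => L2Pair.chain (h n) p) atTop (𝓝 (L2Pair.chain h₀ p)) := by
  refine ((WithLp.prod_continuous_toLp 2 (L2 Ω) (L2Vec Ω)).tendsto _).comp
    (Tendsto.prodMk_nhds ?_ ?_)
  · refine tendsto_L2_of_dominated p.fst (fun n => ?_) ?_
    · filter_upwards [L2Pair.coeFn_chain_fst (h n) p] with x hx
      exact (congrArg norm hx).trans_le ((h n).norm_le _)
    · filter_upwards [ae_all_iff.2 fun n => L2Pair.coeFn_chain_fst (h n) p,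
        L2Pair.coeFn_chain_fst h₀ p] with x h1 h2
      exact ((hβ (p.fst x)).congr fun n => (h1 n).symm).trans_eq (congrArg 𝓝 h2.symm)
  · refine tendsto_L2_of_dominated p.snd (fun n => ?_) ?_
    · filter_upwards [L2Pair.coeFn_chain_snd (h n) p] with x hx
      refine (congrArg norm hx).trans_le ?_
      rw [norm_smul]
      exact mul_le_of_le_one_left (norm_nonneg _) ((h n).bound _)
    · filter_upwards [ae_all_iff.2 fun n => L2Pair.coeFn_chain_snd (h n) p,
        L2Pair.coeFn_chain_snd h₀ p] with x h1 h2
      exact (((hβ' (p.fst x)).smul_const (p.snd x)).congr fun n => (h1 n).symm).trans_eq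
        (congrArg 𝓝 h2.symm)

end Chain

/-! ### Truncations preserve `H¹₀(Ω)` -/

section TestFunctions

variable {d : ℕ} {Ω : Set (Euc d)}

/-- The pair `p` is `(φ, ∇φ)` for a test function `φ`. -/
def L2Pair.IsTest (p : L2Pair Ω) : Prop :=
  ∃ φ : Euc d → ℝ, IsTestFunction Ω φ ∧
    p.fst =ᵐ[volume.restrict Ω] φ ∧ p.snd =ᵐ[volume.restrict Ω] ∇ φ

lemma gradient_add_const_mul {φ ψ : Euc d → ℝ} (hφ : ContDiff ℝ ∞ φ) (hψ : ContDiff ℝ ∞ ψ)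
    (c : ℝ) (x : Euc d) : ∇ (fun x => φ x + c * ψ x) x = ∇ φ x + c • ∇ ψ x := by
  have h1 := (hφ.differentiable (by simp) x)
  have h2 := (hψ.differentiable (by simp) x)
  simp only [gradient]
  rw [fderiv_fun_add h1 (h2.const_mul c), fderiv_const_mul h2]
  simp

lemma L2Pair.IsTest.add_smul {p q : L2Pair Ω} (hp : p.IsTest) (hq : q.IsTest) (c : ℝ) :
    (p + c • q).IsTest := by
  obtain ⟨φ, hφ, h1, h2⟩ := hp
  obtain ⟨ψ, hψ, h3, h4⟩ := hq
  refine ⟨_, hφ.linear_comb hψ c, ?_, ?_⟩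
  · filter_upwards [h1, h3, Lp.coeFn_add p.fst (c • q.fst), Lp.coeFn_smul c q.fst]
      with x e1 e2 e3 e4
    refine Eq.trans e3 ?_
    rw [Pi.add_apply, e4, Pi.smul_apply, e1, e2, smul_eq_mul]
  · filter_upwards [h2, h4, Lp.coeFn_add p.snd (c • q.snd), Lp.coeFn_smul c q.snd]
      with x e1 e2 e3 e4
    refine Eq.trans e3 ?_
    rw [Pi.add_apply, e4, Pi.smul_apply, e1, e2, gradient_add_const_mul hφ.1 hψ.1]

lemma L2Pair.isTest_zero : (0 : L2Pair Ω).IsTest := by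
  refine ⟨fun _ => 0, ⟨contDiff_const, HasCompactSupport.zero, ?_⟩, ?_, ?_⟩
  · rw [tsupport_eq_empty_iff.2 (by rfl)]
    exact empty_subset _
  · exact Lp.coeFn_zero ℝ 2 (volume.restrict Ω)
  · filter_upwards [Lp.coeFn_zero (Euc d) 2 (volume.restrict Ω)] with x hx
    refine Eq.trans hx ?_
    simp [gradient]

lemma L2Pair.isTest_of_mem_span {p : L2Pair Ω}
    (hp : p ∈ Submodule.span ℝ {p : L2Pair Ω | p.IsTest}) : p.IsTest := by
  induction hp using Submodule.span_induction with
  | mem x h => exact h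
  | zero => exact L2Pair.isTest_zero
  | add x y _ _ hx hy => simpa using hx.add_smul hy 1
  | smul c x _ hx => simpa using L2Pair.isTest_zero.add_smul hx c

/-- `H¹₀(Ω)` is the closure of the set of test functions. -/
lemma H10_eq_closure : (H10 Ω : Set (L2Pair Ω)) = closure {p : L2Pair Ω | p.IsTest} := by
  refine (Submodule.topologicalClosure_coe _).trans (congrArg closure ?_)
  exact Subset.antisymm (fun p hp => L2Pair.isTest_of_mem_span hp) Submodule.subset_span

lemma L2Pair.IsTest.chain {β : ℝ → ℝ} (h : IsTruncation β (deriv β)) (hβ : ContDiff ℝ ∞ β)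
    {p : L2Pair Ω} (hp : p.IsTest) : (L2Pair.chain h p).IsTest := by
  obtain ⟨φ, hφ, h1, h2⟩ := hp
  refine ⟨fun x => β (φ x), ⟨hβ.comp hφ.1, hφ.2.1.comp_left h.map_zero, ?_⟩, ?_, ?_⟩
  · exact (tsupport_comp_subset h.map_zero φ).trans hφ.2.2
  · filter_upwards [L2Pair.coeFn_chain_fst h p, h1] with x e1 e2
    rw [e1, e2]
  · filter_upwards [L2Pair.coeFn_chain_snd h p, h1, h2] with x e1 e2 e3
    rw [e1, e2, e3]
    have hd : HasFDerivAt (fun x => β (φ x)) (deriv β (φ x) • fderiv ℝ φ x) x :=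
      (hβ.differentiable (by simp) (φ x)).hasDerivAt.comp_hasFDerivAt x
        (hφ.1.differentiable (by simp) x).hasFDerivAt
    simp only [gradient]
    rw [hd.fderiv]
    simp

lemma L2Pair.chain_mem_H10_of_contDiff {β : ℝ → ℝ} (h : IsTruncation β (deriv β))
    (hβ : ContDiff ℝ ∞ β) {p : L2Pair Ω} (hp : p ∈ H10 Ω) : L2Pair.chain h p ∈ H10 Ω := by
  have hp' : p ∈ closure {p : L2Pair Ω | p.IsTest} := H10_eq_closure.le hp
  exact H10_eq_closure.ge (map_mem_closure
    (L2Pair.continuous_chain h (hβ.continuous_deriv (by simp))) hp' fun q hq => hq.chain h hβ)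

/-- The truncation `s ↦ (s - k)⁺`. -/
lemma isTruncation_posPart {k : ℝ} (hk : 0 ≤ k) :
    IsTruncation (fun s => max (s - k) 0) ((Ioi k).indicator fun _ => 1) where
  lipschitz := by
    refine LipschitzWith.of_dist_le_mul fun x y => ?_
    rw [NNReal.coe_one, one_mul, Real.dist_eq, Real.dist_eq]
    simpa using abs_max_sub_max_le_abs (x - k) (y - k) 0
  -- Here `k ≥ 0` is needed: only a truncation that vanishes at `0` respects zero boundary values.
  map_zero := by simp [hk]
  measurable := measurable_const.indicator measurableSet_Ioi
  bound s := by
    by_cases h : s ∈ Ioi k <;> simp [indicator, h]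

/-- The truncation `s ↦ (s - k)⁺` is the limit of smooth truncations. -/
lemma exists_smooth_truncations {k : ℝ} (hk : 0 ≤ k) :
    ∃ β : ℕ → ℝ → ℝ, (∀ n, IsTruncation (β n) (deriv (β n))) ∧ (∀ n, ContDiff ℝ ∞ (β n)) ∧
      (∀ s, Tendsto (fun n => β n s) atTop (𝓝 (max (s - k) 0))) ∧
      ∀ s, Tendsto (fun n => deriv (β n) s) atTop (𝓝 ((Ioi k).indicator (fun _ => 1) s)) := by
  -- A smooth step rising from `0` at `k` to `1` at `k + 1/(n + 1)`. It is `0` at `k` itself, so it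
  -- converges at every point to the indicator of the open half-line, and no information about the
  -- gradient on the level set `{w = k}` is required.
  set γ : ℕ → ℝ → ℝ := fun n s => Real.smoothTransition ((n + 1) * (s - k)) with hγ
  have hγs : ∀ n, ContDiff ℝ ∞ (γ n) := fun n =>
    Real.smoothTransition.contDiff.comp (by fun_prop)
  have hγ0 : ∀ n s, s ≤ k → γ n s = 0 := fun n s hs =>
    Real.smoothTransition.zero_of_nonpos
      (mul_nonpos_of_nonneg_of_nonpos (by positivity) (by linarith))
  have hγ1 : ∀ n s, |γ n s| ≤ 1 := fun n s => by
    rw [abs_of_nonneg (Real.smoothTransition.nonneg _)]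
    exact Real.smoothTransition.le_one _
  have hγl : ∀ s, k < s → Tendsto (fun n => γ n s) atTop (𝓝 1) := by
    intro s hs
    refine tendsto_const_nhds.congr' ?_
    obtain ⟨N, hN⟩ := exists_nat_gt (1 / (s - k))
    filter_upwards [eventually_ge_atTop N] with n hn
    refine (Real.smoothTransition.one_of_one_le ?_).symm
    have hs' : 0 < s - k := sub_pos.2 hs
    rw [div_lt_iff₀ hs'] at hN
    have : (N : ℝ) ≤ n := by exact_mod_cast hn
    nlinarith
  set β : ℕ → ℝ → ℝ := fun n s => ∫ σ in (0:ℝ)..s, γ n σ with hβ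
  have hd : ∀ n s, HasDerivAt (β n) (γ n s) s := fun n s =>
    ((hγs n).continuous.integral_hasStrictDerivAt 0 s).hasDerivAt
  have hder : ∀ n, deriv (β n) = γ n := fun n => funext fun s => (hd n s).deriv
  have hii : ∀ n a b, IntervalIntegrable (γ n) volume a b := fun n a b =>
    (hγs n).continuous.intervalIntegrable a b
  have hz : ∀ n a b, a ≤ k → b ≤ k → ∫ σ in a..b, γ n σ = 0 := by
    intro n a b ha hb
    rw [intervalIntegral.integral_congr (g := fun _ => 0), intervalIntegral.integral_zero]
    intro σ hσ
    exact hγ0 n σ (hσ.2.trans (max_le ha hb))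
  refine ⟨β, fun n => ⟨?_, ?_, ?_, ?_⟩, fun n => ?_, fun s => ?_, fun s => ?_⟩
  · refine lipschitzWith_of_nnnorm_deriv_le (fun s => (hd n s).differentiableAt) fun s => ?_
    rw [hder, ← NNReal.coe_le_coe]
    simpa using hγ1 n s
  · simp [hβ]
  · rw [hder]
    exact (hγs n).continuous.measurable
  · rw [hder]
    exact hγ1 n
  · rw [contDiff_infty_iff_deriv, hder]
    exact ⟨fun s => (hd n s).differentiableAt, hγs n⟩
  · rcases le_or_gt s k with hs | hs
    · rw [max_eq_right (by linarith)]
      refine tendsto_const_nhds.congr fun n => ?_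
      exact (hz n 0 s hk hs).symm
    · rw [max_eq_left (by linarith)]
      have e : ∀ n, β n s = ∫ σ in k..s, γ n σ := fun n => by
        rw [hβ]
        simp only
        rw [← intervalIntegral.integral_add_adjacent_intervals (hii n 0 k) (hii n k s),
          hz n 0 k hk le_rfl, zero_add]
      simp only [e]
      have e2 : s - k = ∫ _ in k..s, (1:ℝ) := by simp
      rw [e2]
      refine intervalIntegral.tendsto_integral_filter_of_dominated_convergence (fun _ => 1)
        (Eventually.of_forall fun n => (hγs n).continuous.aestronglyMeasurable)
        (Eventually.of_forall fun n => Eventually.of_forall fun σ _ => hγ1 n σ)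
        intervalIntegrable_const (Eventually.of_forall fun σ hσ => hγl σ ?_)
      rw [uIoc_of_le hs.le] at hσ
      exact hσ.1
  · simp only [hder]
    rcases le_or_gt s k with hs | hs
    · rw [indicator_of_notMem (by simpa using hs)]
      exact tendsto_const_nhds.congr fun n => (hγ0 n s hs).symm
    · rw [indicator_of_mem (by simpa using hs)]
      exact hγl s hs

/-- The smooth truncations of `p` stay in `H¹₀(Ω)`, which is closed, and they converge to the
truncation at level `k`. -/
lemma L2Pair.chain_posPart_mem_H10 {k : ℝ} (hk : 0 ≤ k) {p : L2Pair Ω} (hp : p ∈ H10 Ω) :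
    L2Pair.chain (isTruncation_posPart hk) p ∈ H10 Ω := by
  obtain ⟨β, h1, h2, h3, h4⟩ := exists_smooth_truncations hk
  have hcl : IsClosed (H10 Ω : Set (L2Pair Ω)) := Submodule.isClosed_topologicalClosure _
  exact hcl.mem_of_tendsto (L2Pair.tendsto_chain h1 (isTruncation_posPart hk) h3 h4 p)
    (Eventually.of_forall fun n => L2Pair.chain_mem_H10_of_contDiff (h1 n) (h2 n) hp)

/-- The truncation `(w - k)⁺` of `w ∈ H¹₀(Ω)`, for `k ≥ 0`. -/
noncomputable def H10.posPart {k : ℝ} (hk : 0 ≤ k) (w : H10 Ω) : H10 Ω :=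
  ⟨L2Pair.chain (isTruncation_posPart hk) w.1, L2Pair.chain_posPart_mem_H10 hk w.2⟩

/-- The norm bound is immediate. Measurability in time is obtained by writing the truncation as a
pointwise limit of the smooth truncations, which are continuous maps of `H¹₀(Ω)`. -/
lemma H10.memLp_posPart {k T : ℝ} (hk : 0 ≤ k) {U : ℝ → H10 Ω}
    (hU : MemLp U 2 (timeMeasure T)) :
    MemLp (fun t => H10.posPart hk (U t)) 2 (timeMeasure T) := by
  refine hU.mono ?_ (Eventually.of_forall fun t =>
    L2Pair.norm_chain_le (isTruncation_posPart hk) (U t).1)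
  obtain ⟨β, h1, h2, h3, h4⟩ := exists_smooth_truncations hk
  refine aestronglyMeasurable_of_tendsto_ae atTop (f := fun n t =>
    (⟨L2Pair.chain (h1 n) (U t).1, L2Pair.chain_mem_H10_of_contDiff (h1 n) (h2 n) (U t).2⟩ :
      H10 Ω)) (fun n => ?_) (Eventually.of_forall fun t => ?_)
  · have hc : Continuous fun w : H10 Ω => (⟨L2Pair.chain (h1 n) w.1,
        L2Pair.chain_mem_H10_of_contDiff (h1 n) (h2 n) w.2⟩ : H10 Ω) :=
      ((L2Pair.continuous_chain (h1 n) ((h2 n).continuous_deriv (by simp))).comp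
        continuous_subtype_val).subtype_mk _
    exact hc.comp_aestronglyMeasurable hU.1
  · exact tendsto_subtype_rng.2
      (L2Pair.tendsto_chain h1 (isTruncation_posPart hk) h3 h4 (U t).1)

end TestFunctions

/-! ### The flux does no work -/

section Flux

variable {d : ℕ} {Ω : Set (Euc d)}

/-- With `B` the primitive of `b` vanishing at `0`, the integrand is the derivative of `B ∘ φ` in
direction `v`, and `B ∘ φ` has compact support. The integral vanishes by integration by parts
against the constant `1`. -/
lemma IsTestFunction.integral_comp_mul_inner_gradient {φ : Euc d → ℝ} (hφ : IsTestFunction Ω φ)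
    {b : ℝ → ℝ} (hb : Continuous b) (v : Euc d) :
    ∫ x in Ω, b (φ x) * ⟪v, ∇ φ x⟫ = 0 := by
  have hgrad : ∀ x, ⟪v, ∇ φ x⟫ = fderiv ℝ φ x v := fun x => by
    rw [real_inner_comm, gradient, InnerProductSpace.toDual_symm_apply]
  simp only [hgrad]
  have hsupp : ∀ x ∉ Ω, b (φ x) * fderiv ℝ φ x v = 0 := fun x hx => by
    rw [image_eq_zero_of_notMem_tsupport
      fun h => hx (hφ.2.2 (tsupport_fderiv_subset ℝ h))]
    simp
  rw [setIntegral_eq_integral_of_forall_compl_eq_zero hsupp]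
  set B : ℝ → ℝ := fun s => ∫ σ in (0:ℝ)..s, b σ with hB
  have hBd : ∀ s, HasDerivAt B (b s) s := fun s => (hb.integral_hasStrictDerivAt 0 s).hasDerivAt
  have hB0 : B 0 = 0 := by simp [hB]
  have hBc : Continuous B := continuous_iff_continuousAt.2 fun s => (hBd s).continuousAt
  have hdiff : Differentiable ℝ φ := hφ.1.differentiable (by simp)
  have hfd : ∀ x, HasFDerivAt (fun x => B (φ x)) (b (φ x) • fderiv ℝ φ x) x := fun x =>
    (hBd (φ x)).comp_hasFDerivAt x (hdiff x).hasFDerivAt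
  have hfc : Continuous fun x => fderiv ℝ φ x v :=
    (hφ.1.continuous_fderiv (by simp)).clm_apply continuous_const
  have hi1 : Integrable (fun x => b (φ x) * fderiv ℝ φ x v) := by
    refine (Continuous.mul (hb.comp hφ.1.continuous) hfc).integrable_of_hasCompactSupport ?_
    exact HasCompactSupport.mul_left (hφ.2.1.fderiv_apply ℝ v)
  have hi2 : Integrable (fun x => B (φ x)) :=
    (hBc.comp hφ.1.continuous).integrable_of_hasCompactSupport (hφ.2.1.comp_left hB0)
  have key := integral_bilinear_hasLineDerivAt_right_eq_neg_left_of_integrable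
    (μ := (volume : Measure (Euc d))) (f := fun _ => (1:ℝ)) (f' := fun _ => 0)
    (g := fun x => B (φ x)) (g' := fun x => b (φ x) * fderiv ℝ φ x v) (v := v)
    (B := ContinuousLinearMap.mul ℝ ℝ) (by simp) (by simpa using hi1) (by simpa using hi2)
    (fun x _ => by simpa using (hasFDerivAt_const (1:ℝ) x).hasLineDerivAt v)
    (fun x _ => by simpa using (hfd x).hasLineDerivAt v)
  simpa using key

/-- Density: the integral is the `L²` inner product of a constant field with `b(f) G`, hence
continuous in the pair, and it vanishes on test functions. -/
lemma integral_comp_mul_inner_gradient_eq_zero [IsFiniteMeasure (volume.restrict Ω)]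
    {b : ℝ → ℝ} (hb : Continuous b) {C : ℝ} (hC : ∀ s, |b s| ≤ C) (v : Euc d) {p : L2Pair Ω}
    (hp : p ∈ H10 Ω) : ∫ x in Ω, b (p.fst x) * ⟪v, p.snd x⟫ = 0 := by
  have hrepr : ∀ q : L2Pair Ω, ⟪Lp.const 2 (volume.restrict Ω) v,
      L2Pair.mulSnd hb.measurable hC q⟫ = ∫ x in Ω, b (q.fst x) * ⟪v, q.snd x⟫ := by
    intro q
    rw [L2.inner_def]
    refine integral_congr_ae ?_
    filter_upwards [Lp.coeFn_const 2 (volume.restrict Ω) v,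
      L2Pair.coeFn_mulSnd hb.measurable hC q] with x h1 h2
    rw [h1, h2, Function.const_apply, inner_smul_right]
  rw [← hrepr]
  have hcl : IsClosed {q : L2Pair Ω | ⟪Lp.const 2 (volume.restrict Ω) v,
      L2Pair.mulSnd hb.measurable hC q⟫ = 0} :=
    isClosed_eq (continuous_const.inner (L2Pair.continuous_mulSnd hb hC)) continuous_const
  have hp' : p ∈ closure {p : L2Pair Ω | p.IsTest} := H10_eq_closure.le hp
  refine closure_minimal (fun q hq => ?_) hcl hp'
  obtain ⟨φ, hφ, h1, h2⟩ := hq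
  rw [mem_ofPred_eq, hrepr, ← hφ.integral_comp_mul_inner_gradient hb v]
  refine integral_congr_ae ?_
  filter_upwards [h1, h2] with x e1 e2
  rw [e1, e2]

lemma inner_eq_sum_mul_inner_single (a b : Euc d) :
    ⟪a, b⟫ = ∑ j, a j * ⟪EuclideanSpace.single j (1:ℝ), b⟫ := by
  rw [PiLp.inner_apply]
  refine Finset.sum_congr rfl fun j _ => ?_
  rw [EuclideanSpace.inner_single_left]
  simp [mul_comm]

/-- A flux depending on `w` alone does no work against `w ∈ H¹₀(Ω)`. -/
theorem integral_inner_comp_gradient_eq_zero [IsFiniteMeasure (volume.restrict Ω)]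
    {F : ℝ → Euc d} (hF : Continuous F) {C : ℝ} (hC : ∀ s, ‖F s‖ ≤ C) {p : L2Pair Ω}
    (hp : p ∈ H10 Ω) : ∫ x in Ω, ⟪F (p.fst x), p.snd x⟫ = 0 := by
  have hFj : ∀ j, Continuous fun s => F s j := fun j => by fun_prop
  have hCj : ∀ j s, |F s j| ≤ C := fun j s => (PiLp.norm_apply_le (F s) j).trans (hC s)
  have e : ∀ x, ⟪F (p.fst x), p.snd x⟫
      = ∑ j, F (p.fst x) j * ⟪EuclideanSpace.single j (1:ℝ), p.snd x⟫ := fun x =>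
    inner_eq_sum_mul_inner_single _ _
  simp only [e]
  rw [integral_finsetSum]
  · exact Finset.sum_eq_zero fun j _ =>
      integral_comp_mul_inner_gradient_eq_zero (hFj j) (hCj j) _ hp
  · intro j _
    have h1 := (L2Pair.memLp_mul_snd (hFj j).measurable (hCj j) p).integrable (by norm_num)
    refine (h1.const_inner (EuclideanSpace.single j (1:ℝ))).congr
      (Eventually.of_forall fun x => ?_)
    simp only [inner_smul_right]

end Flux

/-! ### Positive parts in `L²` and one-sided integral bounds -/

section PosPart

variable {α : Type*} [MeasurableSpace α] {μ : Measure α}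

/-- Convexity of `f ↦ ‖f⁺‖² / 2` on `L²`. -/
lemma Lp.posPart_sq_sub_le (a b : Lp ℝ 2 μ) :
    ‖Lp.posPart b‖ ^ 2 / 2 - ‖Lp.posPart a‖ ^ 2 / 2 ≤ ⟪b - a, Lp.posPart b⟫ := by
  have h1 : ⟪b, Lp.posPart b⟫ = ‖Lp.posPart b‖ ^ 2 := by
    rw [← real_inner_self_eq_norm_sq, L2.inner_def, L2.inner_def]
    refine integral_congr_ae ?_
    filter_upwards [Lp.coeFn_posPart b] with x hx
    rw [hx]
    rcases le_total (b x) 0 with h | h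
    · simp [max_eq_right h]
    · simp [max_eq_left h]
  have h2 : ⟪a, Lp.posPart b⟫ ≤ ⟪Lp.posPart a, Lp.posPart b⟫ := by
    rw [L2.inner_def, L2.inner_def]
    refine integral_mono_ae (L2.integrable_inner _ _) (L2.integrable_inner _ _) ?_
    filter_upwards [Lp.coeFn_posPart a, Lp.coeFn_posPart b] with x ha hb
    simp only [ha, hb, RCLike.inner_apply, conj_trivial]
    exact mul_le_mul_of_nonneg_left (le_max_left _ _) (le_max_right _ _)
  have h3 := real_inner_le_norm (Lp.posPart a) (Lp.posPart b)
  rw [inner_sub_left, h1]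
  nlinarith [sq_nonneg (‖Lp.posPart a‖ - ‖Lp.posPart b‖)]

lemma Lp.norm_posPart_le_norm (f : Lp ℝ 2 μ) : ‖Lp.posPart f‖ ≤ ‖f‖ := by
  refine Lp.norm_le_norm_of_ae_le ?_
  filter_upwards [Lp.coeFn_posPart f] with x hx
  rw [hx, Real.norm_eq_abs, Real.norm_eq_abs, abs_of_nonneg (le_max_right _ _)]
  exact max_le (le_abs_self _) (abs_nonneg _)

lemma Lp.memLp_posPart {T : ℝ} {f : ℝ → Lp ℝ 2 μ} (hf : MemLp f 2 (timeMeasure T)) :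
    MemLp (fun t => Lp.posPart (f t)) 2 (timeMeasure T) :=
  hf.mono (Lp.continuous_posPart.comp_aestronglyMeasurable hf.1)
    (Eventually.of_forall fun t => Lp.norm_posPart_le_norm (f t))

/-- An upper bound for an integral which need not converge. -/
lemma integral_le_integral_of_le_of_nonneg {f g : α → ℝ} (hg : Integrable g μ)
    (hle : f ≤ᵐ[μ] g) (h0 : 0 ≤ ∫ x, g x ∂μ) : ∫ x, f x ∂μ ≤ ∫ x, g x ∂μ := by
  by_cases hf : Integrable f μ
  -- In the other case the integral of `f` is `0` by convention, which is why `h0` is assumed. This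
  -- avoids proving that the reaction terms are integrable.
  · exact integral_mono_ae hf hg hle
  · rwa [integral_undef hf]

/-- Cauchy–Schwarz and Young. This bounds the cross term `P Q`, produced by both reaction terms, by
the energy. -/
lemma integral_le_mul_half_sq_add {L : ℝ} (hL : 0 ≤ L) (P Q : Lp ℝ 2 μ)
    (hP : ∀ᵐ x ∂μ, 0 ≤ P x) (hQ : ∀ᵐ x ∂μ, 0 ≤ Q x) {g : α → ℝ}
    (hg : ∀ᵐ x ∂μ, g x ≤ L * (P x * Q x)) :
    ∫ x, g x ∂μ ≤ L * (‖P‖ ^ 2 / 2 + ‖Q‖ ^ 2 / 2) := by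
  have e : ∫ x, L * (P x * Q x) ∂μ = L * ⟪P, Q⟫ := by
    rw [L2.inner_def, integral_const_mul]
    congr 1
    refine integral_congr_ae (Eventually.of_forall fun x => ?_)
    simp [mul_comm]
  have hi : Integrable (fun x => L * (P x * Q x)) μ := by
    refine (((L2.integrable_inner (𝕜 := ℝ) P Q)).const_mul L).congr
      (Eventually.of_forall fun x => ?_)
    simp [mul_comm]
  have h0 : 0 ≤ ∫ x, L * (P x * Q x) ∂μ := by
    refine integral_nonneg_of_ae ?_
    filter_upwards [hP, hQ] with x h1 h2
    exact mul_nonneg hL (mul_nonneg h1 h2)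
  refine (integral_le_integral_of_le_of_nonneg hi hg h0).trans ?_
  rw [e]
  refine mul_le_mul_of_nonneg_left ?_ hL
  have := real_inner_le_norm P Q
  nlinarith [sq_nonneg (‖P‖ - ‖Q‖)]

end PosPart

/-- Used to carry the `L²`-valued derivative of `v` to the dual of `L²`, the setting of the energy
inequality. -/
lemma HasWeakTimeDeriv.clm_comp {X Z : Type*} [NormedAddCommGroup X] [NormedSpace ℝ X]
    [CompleteSpace X] [NormedAddCommGroup Z] [NormedSpace ℝ Z] [CompleteSpace Z] {T : ℝ}
    {f g : ℝ → X} (h : HasWeakTimeDeriv T f g) (hf : Integrable f (timeMeasure T))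
    (hg : Integrable g (timeMeasure T)) (A : X →L[ℝ] Z) :
    HasWeakTimeDeriv T (fun t => A (f t)) (fun t => A (g t)) := by
  intro η hη
  have hsm : ∀ {ψ : ℝ → ℝ}, Continuous ψ → HasCompactSupport ψ → ∀ {k : ℝ → X},
      Integrable k (timeMeasure T) → Integrable (fun t => ψ t • k t) (timeMeasure T) := by
    intro ψ hψc hψs k hk
    obtain ⟨C, hC⟩ := hψs.exists_bound_of_continuous hψc
    exact hk.bdd_smul C hψc.aestronglyMeasurable (Eventually.of_forall hC)
  have e1 := A.integral_comp_comm (hsm (hη.1.continuous_deriv (by simp)) hη.2.1.deriv hf)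
  have e2 := A.integral_comp_comm (hsm hη.1.continuous hη.2.1 hg)
  simp only [map_smul] at e1 e2
  rw [e1, e2, h η hη, map_neg]

/-! ### Initial values and the individual terms of the tested equation -/

section Terms

variable {d : ℕ} {Ω : Set (Euc d)}

/-- Meant for `q = (w - k)⁺` with `w₀ ≤ k`, or `q = (l - w)⁺` with `l ≤ w₀`: both are dominated by
`|w - w₀|`, so the energies start from zero. -/
lemma HasInitialValue.tendsto_sq_norm {T : ℝ} (hT : 0 < T) {w : ℝ → Euc d → ℝ} {w₀ : Euc d → ℝ}
    (h : HasInitialValue Ω w w₀) {q : ℝ → L2 Ω}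
    (hq : ∀ᵐ t ∂(timeMeasure T), ∀ᵐ x ∂(volume.restrict Ω), |q t x| ≤ |w t x - w₀ x|) :
    Tendsto (fun t => ‖q t‖ ^ 2 / 2) (𝓝[>] 0 ⊓ ae volume) (𝓝 0) := by
  have h1 : Tendsto (fun t => eLpNorm (q t) 2 (volume.restrict Ω)) (𝓝[>] 0 ⊓ ae volume)
      (𝓝 0) := by
    refine tendsto_of_tendsto_of_tendsto_of_le_of_le' tendsto_const_nhds h
      (Eventually.of_forall fun _ => zero_le) ?_
    have e1 : ∀ᶠ t in 𝓝[>] (0:ℝ) ⊓ ae volume, t ∈ Ioo 0 T :=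
      Filter.Eventually.filter_mono inf_le_left (Ioo_mem_nhdsGT hT)
    have e2 := Filter.Eventually.filter_mono (inf_le_right : 𝓝[>] (0:ℝ) ⊓ ae volume ≤ ae volume)
      ((ae_restrict_iff' measurableSet_Ioo).1 hq)
    filter_upwards [e1, e2] with t ht1 ht2
    exact eLpNorm_mono_ae (ht2 ht1)
  have h2 := (ENNReal.tendsto_toReal ENNReal.zero_ne_top).comp h1
  have h3 : Tendsto (fun t => ‖q t‖) (𝓝[>] 0 ⊓ ae volume) (𝓝 0) := by
    simpa [Lp.norm_def, Function.comp_def] using h2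
  simpa using (h3.pow 2).div_const 2

lemma H10.coeFn_posPart_fst {k : ℝ} (hk : 0 ≤ k) (w : H10 Ω) :
    (H10.posPart hk w).1.fst =ᵐ[volume.restrict Ω] fun x => max (w.1.fst x - k) 0 :=
  L2Pair.coeFn_chain_fst (isTruncation_posPart hk) w.1

lemma H10.coeFn_posPart_snd {k : ℝ} (hk : 0 ≤ k) (w : H10 Ω) :
    (H10.posPart hk w).1.snd =ᵐ[volume.restrict Ω]
      fun x => (Ioi k).indicator (fun _ => (1:ℝ)) (w.1.fst x) • w.1.snd x :=
  L2Pair.coeFn_chain_snd (isTruncation_posPart hk) w.1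

lemma H10.posPart_fst_eq [IsFiniteMeasure (volume.restrict Ω)] {k : ℝ} (hk : 0 ≤ k)
    (w : H10 Ω) :
    (H10.posPart hk w).1.fst = Lp.posPart (w.1.fst - Lp.const 2 (volume.restrict Ω) k) := by
  refine Lp.ext ?_
  filter_upwards [H10.coeFn_posPart_fst hk w,
    Lp.coeFn_posPart (w.1.fst - Lp.const 2 (volume.restrict Ω) k),
    Lp.coeFn_sub w.1.fst (Lp.const 2 (volume.restrict Ω) k),
    Lp.coeFn_const 2 (volume.restrict Ω) k] with x h1 h2 h3 h4
  rw [h1, h2, h3, Pi.sub_apply, h4, Function.const_apply]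

lemma H10.diffusion_posPart_nonneg {k : ℝ} (hk : 0 ≤ k) (w : H10 Ω) {a : Euc d → ℝ}
    (ha : ∀ x, 0 ≤ a x) :
    0 ≤ ∫ x in Ω, a x * ⟪w.1.snd x, (H10.posPart hk w).1.snd x⟫ := by
  refine integral_nonneg_of_ae ?_
  filter_upwards [H10.coeFn_posPart_snd hk w] with x hx
  rw [hx, inner_smul_right]
  exact mul_nonneg (ha x) (mul_nonneg (indicator_nonneg (fun _ _ => zero_le_one) _)
    real_inner_self_nonneg)

/-- Where `w > k` one has `w = k + (w - k)⁺`, and elsewhere the truncated gradient is zero. So the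
flux may be taken as a function of `(w - k)⁺ ∈ H¹₀(Ω)`. -/
lemma H10.flux_posPart_eq_zero [IsFiniteMeasure (volume.restrict Ω)] {k : ℝ} (hk : 0 ≤ k)
    (w : H10 Ω) {F : ℝ → Euc d} (hF : Continuous F) {C : ℝ} (hC : ∀ s, ‖F s‖ ≤ C) :
    ∫ x in Ω, ⟪F (w.1.fst x), (H10.posPart hk w).1.snd x⟫ = 0 := by
  rw [← integral_inner_comp_gradient_eq_zero (F := fun s => F (k + s)) (by fun_prop)
    (fun s => hC (k + s)) (H10.posPart hk w).2]
  refine integral_congr_ae ?_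
  filter_upwards [H10.coeFn_posPart_fst hk w, H10.coeFn_posPart_snd hk w] with x h1 h2
  rw [h1, h2]
  by_cases h : k < w.1.fst x
  · rw [max_eq_left (by linarith), add_sub_cancel]
  · rw [indicator_of_notMem (by simpa using h), zero_smul, inner_zero_right, inner_zero_right]

lemma H10.coeFn_zero_snd : ((0 : H10 Ω).1).snd =ᵐ[volume.restrict Ω] fun _ => (0 : Euc d) :=
  Lp.coeFn_zero (Euc d) 2 (volume.restrict Ω)

lemma H10.coeFn_zero_fst : ((0 : H10 Ω).1).fst =ᵐ[volume.restrict Ω] fun _ => (0 : ℝ) :=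
  Lp.coeFn_zero ℝ 2 (volume.restrict Ω)

end Terms

/-! ### Localization of the weak equations to `(0, s)` -/

section Cutoff

lemma exists_memLp_cutoff {Y : Type*} [NormedAddCommGroup Y] {T : ℝ} (s : ℝ) {φ : ℝ → Y}
    (hφ : MemLp φ 2 (timeMeasure T)) :
    ∃ ψ : ℝ → Y, MemLp ψ 2 (timeMeasure T) ∧ (∀ t ∈ Ioo 0 s, ψ t = φ t) ∧
      ∀ t ∉ Ioo 0 s, ψ t = 0 :=
  ⟨(Ioo 0 s).indicator φ, hφ.indicator measurableSet_Ioo, fun _ ht => indicator_of_mem ht φ,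
    fun _ ht => indicator_of_notMem ht φ⟩

lemma integral_cutoff_eq {T s : ℝ} (hs : s ∈ Ioo 0 T) {K k : ℝ → ℝ}
    (h1 : ∀ t ∈ Ioo 0 s, K t = k t) (h0 : ∀ t ∉ Ioo 0 s, K t = 0) :
    ∫ t, K t ∂(timeMeasure T) = ∫ t in (0:ℝ)..s, k t := by
  have e : K = (Ioo 0 s).indicator k := by
    ext t
    by_cases ht : t ∈ Ioo 0 s
    · rw [indicator_of_mem ht, h1 t ht]
    · rw [indicator_of_notMem ht, h0 t ht]
  rw [e, intervalIntegral.integral_of_le hs.1.le, integral_Ioc_eq_integral_Ioo,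
    integral_indicator measurableSet_Ioo, Measure.restrict_restrict measurableSet_Ioo,
    inter_eq_self_of_subset_left (Ioo_subset_Ioo_right hs.2.le)]

lemma integral_cutoff_le {T s : ℝ} (hs : s ∈ Ioo 0 T) {K g : ℝ → ℝ}
    (hg : Integrable g (timeMeasure T)) (hg0 : ∀ t, 0 ≤ g t)
    (h1 : ∀ᵐ t ∂(timeMeasure T), t ∈ Ioo 0 s → K t ≤ g t) (h0 : ∀ t ∉ Ioo 0 s, K t = 0) :
    ∫ t, K t ∂(timeMeasure T) ≤ ∫ t in (0:ℝ)..s, g t := by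
  rw [← integral_cutoff_eq hs (K := (Ioo 0 s).indicator g)
    (fun t ht => indicator_of_mem ht g) (fun t ht => indicator_of_notMem ht g)]
  refine integral_le_integral_of_le_of_nonneg (hg.indicator measurableSet_Ioo) ?_
    (integral_nonneg (indicator_nonneg fun t _ => hg0 t))
  filter_upwards [h1] with t ht
  by_cases hts : t ∈ Ioo 0 s
  · rw [indicator_of_mem hts]
    exact ht hts
  · rw [indicator_of_notMem hts, h0 t hts]

end Cutoff

/-! ### The equations tested with the truncations -/

section Tested

variable {d : ℕ} {Ω : Set (Euc d)} {T : ℝ} {u v : ℝ → Euc d → ℝ} {P Q : ℝ → L2 Ω} {k l L : ℝ}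

/-- The weak equation for `u`, tested with `(u - k)⁺` on `(0, s)`. -/
lemma integral_posPart_le_of_weak_equation [IsFiniteMeasure (volume.restrict Ω)]
    {D : ℝ → ℝ → ℝ} {F : ℝ → ℝ → Euc d} {Ψ₁ : ℝ → ℝ → ℝ} {U : ℝ → H10 Ω} {U' : ℝ → Hneg1 Ω}
    (hU : MemLp U 2 (timeMeasure T))
    (hu : ∀ᵐ t ∂(timeMeasure T), u t =ᵐ[volume.restrict Ω] (U t).1.fst)
    (hequ : ∀ φ : ℝ → H10 Ω, MemLp φ 2 (timeMeasure T) →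
      (∫ t, U' t (φ t) ∂(timeMeasure T))
        + (∫ t, (∫ x in Ω, D (u t x) (v t x) * ⟪(U t).1.snd x, (φ t).1.snd x⟫) ∂(timeMeasure T))
      = (∫ t, (∫ x in Ω, ⟪F (u t x) (v t x), (φ t).1.snd x⟫) ∂(timeMeasure T))
        + (∫ t, (∫ x in Ω, Ψ₁ (u t x) (v t x) * (φ t).1.fst x) ∂(timeMeasure T)))
    (hD : ∀ a b, 0 ≤ D a b) {f : ℝ → Euc d} (hFf : ∀ a b, F a b = f a) (hf : Continuous f)
    {C : ℝ} (hC : ∀ s, ‖f s‖ ≤ C) (hk : 0 ≤ k) (hL : 0 ≤ L)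
    (hΨ₁ : ∀ a b, k ≤ a → Ψ₁ a b ≤ L * max (l - b) 0)
    (hφP : ∀ t, (H10.posPart hk (U t)).1.fst = P t)
    (hP0 : ∀ t, ∀ᵐ x ∂(volume.restrict Ω), 0 ≤ P t x)
    (hQ0 : ∀ t, ∀ᵐ x ∂(volume.restrict Ω), 0 ≤ Q t x)
    (hPx : ∀ᵐ t ∂(timeMeasure T), ∀ᵐ x ∂(volume.restrict Ω), P t x = max (u t x - k) 0)
    (hQx : ∀ᵐ t ∂(timeMeasure T), ∀ᵐ x ∂(volume.restrict Ω), Q t x = max (l - v t x) 0)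
    (hEi : Integrable (fun t => ‖P t‖ ^ 2 / 2 + ‖Q t‖ ^ 2 / 2) (timeMeasure T))
    {s : ℝ} (hs : s ∈ Ioo 0 T) :
    ∫ t in (0:ℝ)..s, U' t (H10.posPart hk (U t))
      ≤ ∫ t in (0:ℝ)..s, L * (‖P t‖ ^ 2 / 2 + ‖Q t‖ ^ 2 / 2) := by
  have hLE0 : ∀ t, 0 ≤ L * (‖P t‖ ^ 2 / 2 + ‖Q t‖ ^ 2 / 2) := fun t =>
    mul_nonneg hL (by positivity)
  obtain ⟨ψ, hψL, hψ1, hψ0⟩ := exists_memLp_cutoff s (H10.memLp_posPart hk hU)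
  have heq := hequ ψ hψL
  rw [integral_cutoff_eq hs (k := fun t => U' t (H10.posPart hk (U t))) (fun t ht => by rw [hψ1 t ht])
    (fun t ht => by rw [hψ0 t ht, map_zero])] at heq
  have hdiff : 0 ≤ ∫ t, (∫ x in Ω, D (u t x) (v t x) * ⟪(U t).1.snd x, (ψ t).1.snd x⟫)
      ∂(timeMeasure T) := by
    refine integral_nonneg fun t => ?_
    by_cases ht : t ∈ Ioo 0 s
    · rw [hψ1 t ht]
      exact H10.diffusion_posPart_nonneg hk (U t) fun x => hD _ _
    · rw [hψ0 t ht]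
      refine (integral_eq_zero_of_ae ?_).ge
      filter_upwards [H10.coeFn_zero_snd (Ω := Ω)] with x hx
      rw [hx, inner_zero_right, mul_zero, Pi.zero_apply]
  have hflux : ∫ t, (∫ x in Ω, ⟪F (u t x) (v t x), (ψ t).1.snd x⟫) ∂(timeMeasure T) = 0 := by
    refine integral_eq_zero_of_ae ?_
    filter_upwards [hu] with t hut
    by_cases ht : t ∈ Ioo 0 s
    · rw [hψ1 t ht, Pi.zero_apply, ← H10.flux_posPart_eq_zero hk (U t) hf hC]
      refine integral_congr_ae ?_
      filter_upwards [hut] with x hx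
      rw [hFf, hx]
    · rw [hψ0 t ht]
      refine integral_eq_zero_of_ae ?_
      filter_upwards [H10.coeFn_zero_snd (Ω := Ω)] with x hx
      rw [hx, inner_zero_right, Pi.zero_apply]
  have hreac : ∫ t, (∫ x in Ω, Ψ₁ (u t x) (v t x) * (ψ t).1.fst x) ∂(timeMeasure T)
      ≤ ∫ t in (0:ℝ)..s, L * (‖P t‖ ^ 2 / 2 + ‖Q t‖ ^ 2 / 2) := by
    refine integral_cutoff_le hs (hEi.const_mul L) hLE0 ?_ fun t ht => ?_
    · filter_upwards [hPx, hQx] with t hpx hqx ht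
      rw [hψ1 t ht, hφP t]
      refine integral_le_mul_half_sq_add hL (P t) (Q t) (hP0 t) (hQ0 t) ?_
      filter_upwards [hpx, hqx] with x h1 h2
      rw [h1, h2]
      -- The factor `(u - k)⁺` vanishes below `k`, so the reaction bound is needed only for `u ≥ k`.
      rcases le_total k (u t x) with hku | hku
      · calc Ψ₁ (u t x) (v t x) * max (u t x - k) 0
            ≤ (L * max (l - v t x) 0) * max (u t x - k) 0 :=
              mul_le_mul_of_nonneg_right (hΨ₁ _ _ hku) (le_max_right _ _)
          _ = L * (max (u t x - k) 0 * max (l - v t x) 0) := by ring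
      · rw [max_eq_right (by linarith : u t x - k ≤ 0)]
        simp
    · rw [hψ0 t ht]
      refine integral_eq_zero_of_ae ?_
      filter_upwards [H10.coeFn_zero_fst (Ω := Ω)] with x hx
      rw [hx, mul_zero, Pi.zero_apply]
  linarith

/-- The weak equation for `v`, tested with `-(l - v)⁺` on `(0, s)`. -/
lemma integral_neg_posPart_le_of_weak_equation
    {Ψ₂ : ℝ → ℝ → ℝ} {V' : ℝ → L2 Ω} (hQn : MemLp (fun t => -Q t) 2 (timeMeasure T))
    (heqv : ∀ ξ : ℝ → L2 Ω, MemLp ξ 2 (timeMeasure T) →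
      ∫ t, (∫ x in Ω, V' t x * ξ t x) ∂(timeMeasure T)
      = ∫ t, (∫ x in Ω, Ψ₂ (u t x) (v t x) * ξ t x) ∂(timeMeasure T)) (hL : 0 ≤ L)
    (hΨ₂ : ∀ a b, b ≤ l → -Ψ₂ a b ≤ L * max (a - k) 0)
    (hP0 : ∀ t, ∀ᵐ x ∂(volume.restrict Ω), 0 ≤ P t x)
    (hQ0 : ∀ t, ∀ᵐ x ∂(volume.restrict Ω), 0 ≤ Q t x)
    (hPx : ∀ᵐ t ∂(timeMeasure T), ∀ᵐ x ∂(volume.restrict Ω), P t x = max (u t x - k) 0)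
    (hQx : ∀ᵐ t ∂(timeMeasure T), ∀ᵐ x ∂(volume.restrict Ω), Q t x = max (l - v t x) 0)
    (hEi : Integrable (fun t => ‖P t‖ ^ 2 / 2 + ‖Q t‖ ^ 2 / 2) (timeMeasure T))
    {s : ℝ} (hs : s ∈ Ioo 0 T) :
    ∫ t in (0:ℝ)..s, (innerSL ℝ (V' t)) (-Q t)
      ≤ ∫ t in (0:ℝ)..s, L * (‖P t‖ ^ 2 / 2 + ‖Q t‖ ^ 2 / 2) := by
  have hLE0 : ∀ t, 0 ≤ L * (‖P t‖ ^ 2 / 2 + ‖Q t‖ ^ 2 / 2) := fun t =>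
    mul_nonneg hL (by positivity)
  obtain ⟨ψ, hψL, hψ1, hψ0⟩ := exists_memLp_cutoff s hQn
  have heq := heqv ψ hψL
  rw [integral_cutoff_eq hs (k := fun t => (innerSL ℝ (V' t)) (-Q t))] at heq
  · rw [heq]
    refine integral_cutoff_le hs (hEi.const_mul L) hLE0 ?_ fun t ht => ?_
    · filter_upwards [hPx, hQx] with t hpx hqx ht
      rw [hψ1 t ht]
      refine integral_le_mul_half_sq_add hL (P t) (Q t) (hP0 t) (hQ0 t) ?_
      filter_upwards [hpx, hqx, Lp.coeFn_neg (Q t)] with x h1 h2 h3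
      rw [h3, Pi.neg_apply, h1, h2]
      rcases le_total (v t x) l with hvl | hvl
      · calc Ψ₂ (u t x) (v t x) * -max (l - v t x) 0
            = -Ψ₂ (u t x) (v t x) * max (l - v t x) 0 := by ring
          _ ≤ (L * max (u t x - k) 0) * max (l - v t x) 0 :=
              mul_le_mul_of_nonneg_right (hΨ₂ _ _ hvl) (le_max_right _ _)
          _ = L * (max (u t x - k) 0 * max (l - v t x) 0) := by ring
      · rw [max_eq_right (by linarith : l - v t x ≤ 0)]
        simp
    · rw [hψ0 t ht]
      refine integral_eq_zero_of_ae ?_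
      filter_upwards [Lp.coeFn_zero ℝ 2 (volume.restrict Ω)] with x hx
      rw [hx, Pi.zero_apply, mul_zero]
  · intro t ht
    rw [hψ1 t ht, innerSL_apply_apply, L2.inner_def]
    refine integral_congr_ae (Eventually.of_forall fun x => ?_)
    simp [mul_comm]
  · intro t ht
    rw [hψ0 t ht]
    refine integral_eq_zero_of_ae ?_
    filter_upwards [Lp.coeFn_zero ℝ 2 (volume.restrict Ω)] with x hx
    rw [hx, Pi.zero_apply, mul_zero]

end Tested

/-! ### The coupled Gronwall argument -/

lemma eq_zero_of_half_sq_add_eq_zero {X : Type*} [NormedAddCommGroup X] {P Q : X}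
    (h : ‖P‖ ^ 2 / 2 + ‖Q‖ ^ 2 / 2 = 0) : P = 0 ∧ Q = 0 := by
  have h1 : ‖P‖ ^ 2 = 0 := by nlinarith [sq_nonneg ‖P‖, sq_nonneg ‖Q‖]
  have h2 : ‖Q‖ ^ 2 = 0 := by nlinarith [sq_nonneg ‖P‖, sq_nonneg ‖Q‖]
  exact ⟨norm_eq_zero.1 (pow_eq_zero_iff two_ne_zero |>.1 h1),
    norm_eq_zero.1 (pow_eq_zero_iff two_ne_zero |>.1 h2)⟩

/-- One half of the maximum principle: `u ≤ k` and `l ≤ v`. -/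
theorem IsWeakSolution.le_and_ge {d : ℕ} {Ω : Set (Euc d)} [IsFiniteMeasure (volume.restrict Ω)]
    {T : ℝ} (hT : 0 < T) {D : ℝ → ℝ → ℝ} {F : ℝ → ℝ → Euc d} {Ψ₁ Ψ₂ : ℝ → ℝ → ℝ}
    {u₀ v₀ : Euc d → ℝ} {u v : ℝ → Euc d → ℝ}
    (h : IsWeakSolution Ω T D F Ψ₁ Ψ₂ u₀ v₀ u v) (hD : ∀ a b, 0 ≤ D a b)
    {f : ℝ → Euc d} (hFf : ∀ a b, F a b = f a) (hf : Continuous f) {C : ℝ}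
    (hC : ∀ s, ‖f s‖ ≤ C) {k l L : ℝ} (hk : 0 ≤ k) (hL : 0 ≤ L)
    (hΨ₁ : ∀ a b, k ≤ a → Ψ₁ a b ≤ L * max (l - b) 0)
    (hΨ₂ : ∀ a b, b ≤ l → -Ψ₂ a b ≤ L * max (a - k) 0)
    (hu₀ : ∀ᵐ x ∂(volume.restrict Ω), u₀ x ≤ k) (hv₀ : ∀ᵐ x ∂(volume.restrict Ω), l ≤ v₀ x) :
    ∀ᵐ t ∂(timeMeasure T), ∀ᵐ x ∂(volume.restrict Ω), u t x ≤ k ∧ l ≤ v t x := by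
  obtain ⟨U, V, U', V', ⟨-, hu⟩, hU, hU', hUd, ⟨-, hv⟩, hV, hV', hVd, hui, hvi, hequ, heqv⟩ := h
  set μ := (volume : Measure (Euc d)).restrict Ω with hμ
  set i : H10 Ω →L[ℝ] L2 Ω := (WithLp.fstL 2 ℝ (L2 Ω) (L2Vec Ω)).comp (H10 Ω).subtypeL with hi
  have hUL : MemLp (fun t => (U t).1.fst) 2 (timeMeasure T) := i.comp_memLp' hU
  have hVL : MemLp (fun t => (V t).1.fst) 2 (timeMeasure T) :=
    ((WithLp.fstL 2 ℝ (L2 Ω) (L2Vec Ω)).comp (H1 Ω).subtypeL).comp_memLp' hV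
  set A : ℝ → L2 Ω := fun t => (U t).1.fst - Lp.const 2 μ k with hA
  set B : ℝ → L2 Ω := fun t => Lp.const 2 μ l - (V t).1.fst with hB
  have hAL : MemLp A 2 (timeMeasure T) := hUL.sub (memLp_const _)
  have hBL : MemLp B 2 (timeMeasure T) := (memLp_const _).sub hVL
  set P : ℝ → L2 Ω := fun t => Lp.posPart (A t) with hP
  set Q : ℝ → L2 Ω := fun t => Lp.posPart (B t) with hQ
  have hPL : MemLp P 2 (timeMeasure T) := Lp.memLp_posPart hAL
  have hQL : MemLp Q 2 (timeMeasure T) := Lp.memLp_posPart hBL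
  have hPi : Integrable (fun t => ‖P t‖ ^ 2 / 2) (timeMeasure T) :=
    (hPL.integrable_norm_pow (p := 2) (by simp)).div_const 2
  have hQi : Integrable (fun t => ‖Q t‖ ^ 2 / 2) (timeMeasure T) :=
    (hQL.integrable_norm_pow (p := 2) (by simp)).div_const 2
  -- pointwise values
  have hPx : ∀ᵐ t ∂(timeMeasure T), ∀ᵐ x ∂μ, P t x = max (u t x - k) 0 := by
    filter_upwards [hu] with t ht
    filter_upwards [ht, Lp.coeFn_posPart (A t), Lp.coeFn_sub (U t).1.fst (Lp.const 2 μ k),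
      Lp.coeFn_const 2 μ k] with x h1 h2 h3 h4
    rw [h1]
    refine h2.trans ?_
    rw [h3, Pi.sub_apply, h4, Function.const_apply]
  have hQx : ∀ᵐ t ∂(timeMeasure T), ∀ᵐ x ∂μ, Q t x = max (l - v t x) 0 := by
    filter_upwards [hv] with t ht
    filter_upwards [ht, Lp.coeFn_posPart (B t), Lp.coeFn_sub (Lp.const 2 μ l) (V t).1.fst,
      Lp.coeFn_const 2 μ l] with x h1 h2 h3 h4
    rw [h1]
    refine h2.trans ?_
    rw [h3, Pi.sub_apply, h4, Function.const_apply]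
  have hP0 : ∀ t, ∀ᵐ x ∂μ, 0 ≤ P t x := fun t => by
    filter_upwards [Lp.coeFn_posPart (A t)] with x hx
    exact (le_max_right _ _).trans_eq hx.symm
  have hQ0 : ∀ t, ∀ᵐ x ∂μ, 0 ≤ Q t x := fun t => by
    filter_upwards [Lp.coeFn_posPart (B t)] with x hx
    exact (le_max_right _ _).trans_eq hx.symm
  -- initial values
  have hP00 : Tendsto (fun t => ‖P t‖ ^ 2 / 2) (𝓝[>] 0 ⊓ ae volume) (𝓝 0) := by
    refine hui.tendsto_sq_norm hT ?_
    filter_upwards [hPx] with t ht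
    filter_upwards [ht, hu₀] with x h1 h2
    rw [h1, abs_of_nonneg (le_max_right _ _)]
    exact max_le ((by linarith : u t x - k ≤ u t x - u₀ x).trans (le_abs_self _)) (abs_nonneg _)
  have hQ00 : Tendsto (fun t => ‖Q t‖ ^ 2 / 2) (𝓝[>] 0 ⊓ ae volume) (𝓝 0) := by
    refine hvi.tendsto_sq_norm hT ?_
    filter_upwards [hQx] with t ht
    filter_upwards [ht, hv₀] with x h1 h2
    rw [h1, abs_of_nonneg (le_max_right _ _)]
    exact max_le ((by linarith : l - v t x ≤ -(v t x - v₀ x)).trans (neg_le_abs _)) (abs_nonneg _)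
  -- energy inequalities
  set φ : ℝ → H10 Ω := fun t => H10.posPart hk (U t) with hφ
  have hφL : MemLp φ 2 (timeMeasure T) := H10.memLp_posPart hk hU
  have hφP : ∀ t, (φ t).1.fst = P t := fun t => H10.posPart_fst_eq hk (U t)
  have hEU : ∀ᵐ s ∂(timeMeasure T), ‖P s‖ ^ 2 / 2 ≤ ∫ t in (0:ℝ)..s, U' t (φ t) := by
    refine HasWeakTimeDeriv.energy_le hT i hUL hU' hφL hUd hPi (fun s t => ?_) hP00
    have e1 : i (φ t) = P t := hφP t
    have e2 : (U t).1.fst - (U s).1.fst = A t - A s := (sub_sub_sub_cancel_right _ _ _).symm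
    rw [e1, e2]
    exact Lp.posPart_sq_sub_le (A s) (A t)
  have hQn : MemLp (fun t => -Q t) 2 (timeMeasure T) := hQL.neg
  -- The test function is `-Q` because the gradient of `V ↦ ‖(l - V)⁺‖² / 2` is `-(l - V)⁺`.
  have hEV : ∀ᵐ s ∂(timeMeasure T), ‖Q s‖ ^ 2 / 2
      ≤ ∫ t in (0:ℝ)..s, (innerSL ℝ (V' t)) (-Q t) := by
    have hd := hVd.clm_comp (hVL.integrable (by norm_num)) (hV'.integrable (by norm_num))
      (innerSL ℝ : L2 Ω →L[ℝ] L2 Ω →L[ℝ] ℝ)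
    refine HasWeakTimeDeriv.energy_le hT (ContinuousLinearMap.id ℝ (L2 Ω)) hVL
      ((innerSL ℝ : L2 Ω →L[ℝ] L2 Ω →L[ℝ] ℝ).comp_memLp' hV') hQn hd hQi (fun s t => ?_) hQ00
    have e2 : (V t).1.fst - (V s).1.fst = -(B t - B s) := by
      simp only [hB]
      abel
    rw [ContinuousLinearMap.id_apply, e2, inner_neg_neg]
    exact Lp.posPart_sq_sub_le (B s) (B t)
  set E : ℝ → ℝ := fun t => ‖P t‖ ^ 2 / 2 + ‖Q t‖ ^ 2 / 2 with hE
  have hEi : Integrable E (timeMeasure T) := hPi.add hQi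
  have hE0 : ∀ t, 0 ≤ E t := fun t => by positivity
  have hBU : ∀ s ∈ Ioo 0 T, ∫ t in (0:ℝ)..s, U' t (φ t) ≤ ∫ t in (0:ℝ)..s, L * E t := fun s hs =>
    integral_posPart_le_of_weak_equation hU hu hequ hD hFf hf hC hk hL hΨ₁ hφP hP0 hQ0 hPx hQx
      hEi hs
  have hBV : ∀ s ∈ Ioo 0 T, ∫ t in (0:ℝ)..s, (innerSL ℝ (V' t)) (-Q t)
      ≤ ∫ t in (0:ℝ)..s, L * E t := fun s hs =>
    integral_neg_posPart_le_of_weak_equation hQn heqv hL hΨ₂ hP0 hQ0 hPx hQx hEi hs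
  have hEz : ∀ᵐ s ∂(timeMeasure T), E s = 0 := by
    -- Each of the two equations contributes `L ∫ E`.
    refine ae_eq_zero_of_le_mul_primitive (C := 2 * L) hT hEi hE0 ?_
    filter_upwards [hEU, hEV, ae_restrict_mem measurableSet_Ioo] with s h1 h2 hs
    have h3 := hBU s hs
    have h4 := hBV s hs
    rw [intervalIntegral.integral_const_mul] at h3 h4
    simp only [hE] at h3 h4 ⊢
    linarith
  filter_upwards [hEz, hPx, hQx] with t ht hpx hqx
  obtain ⟨hPz, hQz⟩ := eq_zero_of_half_sq_add_eq_zero (P := P t) (Q := Q t) ht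
  rw [hPz] at hpx
  rw [hQz] at hqx
  filter_upwards [hpx, hqx, Lp.coeFn_zero ℝ 2 μ] with x h1 h2 h3
  rw [h3, Pi.zero_apply] at h1 h2
  exact ⟨by linarith [le_max_left (u t x - k) 0], by linarith [le_max_left (l - v t x) 0]⟩

/-! ### Reflection of the unknowns -/

section Negation

lemma memLp_neg_dual {Y : Type*} [NormedAddCommGroup Y] [NormedSpace ℝ Y] {T : ℝ}
    {f : ℝ → Y →L[ℝ] ℝ} (hf : MemLp f 2 (timeMeasure T)) :
    MemLp (fun t => -f t) 2 (timeMeasure T) := by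
  refine hf.of_le (g := f) (continuous_neg.comp_aestronglyMeasurable hf.1) ?_
  exact Eventually.of_forall fun t => (norm_neg (f t)).le

variable {d : ℕ} {Ω : Set (Euc d)} {T : ℝ}

lemma HasWeakTimeDeriv.neg {X : Type*} [NormedAddCommGroup X] [NormedSpace ℝ X]
    {f g : ℝ → X} (h : HasWeakTimeDeriv T f g) :
    HasWeakTimeDeriv T (fun t => -f t) (fun t => -g t) := by
  intro η hη
  simp only [smul_neg, integral_neg]
  rw [h η hη]

lemma HasInitialValue.neg {w : ℝ → Euc d → ℝ} {w₀ : Euc d → ℝ} (h : HasInitialValue Ω w w₀) :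
    HasInitialValue Ω (fun t x => -w t x) (fun x => -w₀ x) := by
  refine h.congr fun t => ?_
  rw [← eLpNorm_neg]
  congr 1
  ext x
  simp only [Pi.neg_apply, Pi.sub_apply]
  ring

lemma Represents.neg {w : ℝ → Euc d → ℝ} {W : ℝ → L2 Ω} (h : Represents Ω T w W) :
    Represents Ω T (fun t x => -w t x) (fun t => -W t) := by
  refine ⟨h.1.neg, ?_⟩
  filter_upwards [h.2] with t ht
  filter_upwards [ht, Lp.coeFn_neg (W t)] with x h1 h2
  rw [h2, Pi.neg_apply, h1]

lemma L2.toHneg1_neg (f : L2 Ω) : L2.toHneg1 (-f) = -L2.toHneg1 f := by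
  simp [L2.toHneg1]

/-- The change of unknowns `(u, v) ↦ (-u, -v)`. -/
theorem IsWeakSolution.neg {D : ℝ → ℝ → ℝ} {F : ℝ → ℝ → Euc d} {Ψ₁ Ψ₂ : ℝ → ℝ → ℝ}
    {u₀ v₀ : Euc d → ℝ} {u v : ℝ → Euc d → ℝ} (h : IsWeakSolution Ω T D F Ψ₁ Ψ₂ u₀ v₀ u v) :
    IsWeakSolution Ω T (fun a b => D (-a) (-b)) (fun a b => -F (-a) (-b))
      (fun a b => -Ψ₁ (-a) (-b)) (fun a b => -Ψ₂ (-a) (-b)) (fun x => -u₀ x) (fun x => -v₀ x)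
      (fun t x => -u t x) (fun t x => -v t x) := by
  obtain ⟨U, V, U', V', hu, hU, hU', hUd, hv, hV, hV', hVd, hui, hvi, hequ, heqv⟩ := h
  have hU'n : MemLp (fun t => -U' t) 2 (timeMeasure T) := memLp_neg_dual hU'
  have hUdn : HasWeakTimeDeriv T (fun t => L2.toHneg1 (-(U t).1.fst)) (fun t => -U' t) := by
    rw [show (fun t => L2.toHneg1 (-(U t).1.fst)) = fun t => -L2.toHneg1 (U t).1.fst from
      funext fun t => L2.toHneg1_neg _]
    exact hUd.neg
  refine ⟨fun t => -U t, fun t => -V t, fun t => -U' t, fun t => -V' t, hu.neg, hU.neg,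
    hU'n, hUdn, hv.neg, hV.neg, hV'.neg, hVd.neg, hui.neg, hvi.neg, fun φ hφ => ?_, fun ξ hξ => ?_⟩
  · have e1 : ∀ t, ∫ x in Ω, D (u t x) (v t x) * ⟪(-U t).1.snd x, (φ t).1.snd x⟫
        = -∫ x in Ω, D (u t x) (v t x) * ⟪(U t).1.snd x, (φ t).1.snd x⟫ := by
      intro t
      rw [← integral_neg]
      refine integral_congr_ae ?_
      filter_upwards [Lp.coeFn_neg (U t).1.snd] with x hx
      rw [show (-U t).1.snd = -(U t).1.snd from rfl, hx, Pi.neg_apply, inner_neg_left, mul_neg]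
    simp only [neg_neg, e1, _root_.neg_apply, inner_neg_left, neg_mul, integral_neg]
    linarith [hequ φ hφ]
  · have e1 : ∀ t, ∫ x in Ω, (-V' t : L2 Ω) x * ξ t x = -∫ x in Ω, V' t x * ξ t x := by
      intro t
      rw [← integral_neg]
      refine integral_congr_ae ?_
      filter_upwards [Lp.coeFn_neg (V' t)] with x hx
      rw [hx, Pi.neg_apply, neg_mul]
    simp only [neg_neg, e1, neg_mul, integral_neg, neg_inj]
    exact heqv ξ hξ

end Negation

/-! ### Essential bounds, product measure and the conclusion -/

/-- In `ℝ`, which is only conditionally complete, these bounds require `f` to be essentially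
bounded; the `L^∞` norm supplies this. -/
lemma MemLp.ae_mem_Icc_essInf_essSup {α : Type*} [MeasurableSpace α] {μ : Measure α}
    {f : α → ℝ} (hf : MemLp f ∞ μ) : ∀ᵐ x ∂μ, essInf f μ ≤ f x ∧ f x ≤ essSup f μ := by
  obtain ⟨C, hC⟩ : ∃ C : ℝ, ∀ᵐ x ∂μ, |f x| ≤ C := by
    refine ⟨(eLpNorm f ∞ μ).toReal, ?_⟩
    filter_upwards [enorm_ae_le_eLpNormEssSup f μ] with x hx
    rw [← eLpNorm_exponent_top] at hx
    have := ENNReal.toReal_mono hf.2.ne hx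
    simpa using this
  have h1 : IsBoundedUnder (· ≥ ·) (ae μ) f :=
    ⟨-C, eventually_map.2 (hC.mono fun x hx => (abs_le.1 hx).1)⟩
  have h2 : IsBoundedUnder (· ≤ ·) (ae μ) f :=
    ⟨C, eventually_map.2 (hC.mono fun x hx => (abs_le.1 hx).2)⟩
  filter_upwards [ae_essInf_le h1, ae_le_essSup h2] with x e1 e2
  exact ⟨e1, e2⟩

/-- Passage from almost every `t` and almost every `x` to almost every `(t, x)`. -/
lemma ae_prod_of_ae_ae_mem {α β : Type*} [MeasurableSpace α] [MeasurableSpace β] {μ : Measure α}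
    {ν : Measure β} [SFinite ν] {w z : α → β → ℝ}
    (hw : AEStronglyMeasurable (Function.uncurry w) (μ.prod ν))
    (hz : AEStronglyMeasurable (Function.uncurry z) (μ.prod ν)) {S : Set (ℝ × ℝ)}
    (hS : MeasurableSet S) (h : ∀ᵐ t ∂μ, ∀ᵐ x ∂ν, (w t x, z t x) ∈ S) :
    ∀ᵐ p ∂(μ.prod ν), (w p.1 p.2, z p.1 p.2) ∈ S := by
  -- Measurable representatives are substituted because the converse direction of Fubini for null
  -- sets needs a measurable set in the product.
  have hm : MeasurableSet {p | (hw.mk _ p, hz.mk _ p) ∈ S} :=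
    (hw.stronglyMeasurable_mk.measurable.prodMk hz.stronglyMeasurable_mk.measurable) hS
  have key : ∀ᵐ p ∂(μ.prod ν), (hw.mk _ p, hz.mk _ p) ∈ S := by
    rw [Measure.ae_prod_iff_ae_ae hm]
    filter_upwards [h, Measure.ae_ae_of_ae_prod hw.ae_eq_mk, Measure.ae_ae_of_ae_prod hz.ae_eq_mk]
      with t h1 h2 h3
    filter_upwards [h1, h2, h3] with x e1 e2 e3
    rw [← e2, ← e3]
    exact e1
  filter_upwards [key, hw.ae_eq_mk, hz.ae_eq_mk] with p h1 h2 h3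
  have e : (w p.1 p.2, z p.1 p.2) = (hw.mk _ p, hz.mk _ p) := Prod.ext h2 h3
  rw [e]
  exact h1

/-- Growth of a nonincreasing Lipschitz reaction term beyond a point where it is nonpositive. -/
lemma le_mul_max_of_antitone {g : ℝ → ℝ → ℝ} {k l L : ℝ} (hk : g k l ≤ 0)
    (ha : ∀ b, Antitone fun a => g a b) (hb : ∀ a, Antitone (g a))
    (hL : ∀ b, |g k b - g k l| ≤ L * |b - l|) {a b : ℝ} (hab : k ≤ a) :
    g a b ≤ L * max (l - b) 0 := by
  have h1 : g a b ≤ g k b := ha b hab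
  rcases le_total b l with h | h
  · have h2 := (le_abs_self _).trans (hL b)
    rw [abs_of_nonpos (by linarith : b - l ≤ 0)] at h2
    rw [max_eq_left (by linarith)]
    linarith [show L * -(b - l) = L * (l - b) by ring]
  · have h2 : g k b ≤ g k l := hb k h
    rw [max_eq_right (by linarith), mul_zero]
    linarith

theorem mainTheorem2 {d : ℕ} (Ω : Set (Euc d)) (hΩ_open : IsOpen Ω) (hΩ_conn : IsConnected Ω)
    (hΩ_bdd : Bornology.IsBounded Ω) (hΩ_C1 : HasC1Boundary Ω)
    (T : ℝ) (hT : 0 < T)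
    (D : ℝ → ℝ → ℝ) (F : ℝ → ℝ → Euc d) (Ψ₁ Ψ₂ : ℝ → ℝ → ℝ) (u₀ v₀ : Euc d → ℝ)
    -- diffusivity
    (hD : ContDiff ℝ 1 (Function.uncurry D))
    (hD_bdd : ∃ Dm DM : ℝ, 0 < Dm ∧ ∀ a b, Dm ≤ D a b ∧ D a b ≤ DM)
    -- flux
    (hF : ∀ j, ContDiff ℝ 1 (fun p : ℝ × ℝ => F p.1 p.2 j))
    (hF_bdd : ∃ FM : ℝ, 0 < FM ∧ ∀ a b, ‖F a b‖ ≤ FM)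
    -- reaction terms: Lipschitz, and nonincreasing in each variable
    (hΨ : ∃ Ψu Ψv : ℝ, 0 < Ψu ∧ 0 < Ψv ∧ ∀ a₁ a₂ b₁ b₂,
      |Ψ₁ a₁ b₁ - Ψ₁ a₂ b₂| ≤ Ψu * |a₁ - a₂| + Ψv * |b₁ - b₂| ∧
      |Ψ₂ a₁ b₁ - Ψ₂ a₂ b₂| ≤ Ψu * |a₁ - a₂| + Ψv * |b₁ - b₂|)
    (hΨ₁_u : ∀ b, Antitone (fun a => Ψ₁ a b)) (hΨ₁_v : ∀ a, Antitone (Ψ₁ a))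
    (hΨ₂_u : ∀ b, Antitone (fun a => Ψ₂ a b)) (hΨ₂_v : ∀ a, Antitone (Ψ₂ a))
    -- initial data; the last condition is `Ψ₂(0, v₀) = 0` on `∂Ω`
    (hu₀ : MemLp u₀ ∞ (volume.restrict Ω))
    (hv₀ : MemLp v₀ ∞ (volume.restrict Ω)) (hv₀_H1 : MemH1 Ω v₀)
    (hv₀_bdry : MemH10 Ω (fun x => Ψ₂ 0 (v₀ x)))
    -- hypotheses of the maximum principle
    (hF_u : ∀ a b b', F a b = F a b')
    (vl vr : ℝ) (hvl : vl = essInf v₀ (volume.restrict Ω))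
    (hvr : vr = essSup v₀ (volume.restrict Ω))
    (ul ur : ℝ) (hul_ur : ul < ur) (hul : ul ≤ 0) (hur : 0 ≤ ur)
    (hu₀_mem : ∀ᵐ x ∂(volume.restrict Ω), u₀ x ∈ Icc ul ur)
    (h_r : Ψ₁ ur vl ≤ 0 ∧ 0 ≤ Ψ₂ ur vl) (h_l : Ψ₂ ul vr ≤ 0 ∧ 0 ≤ Ψ₁ ul vr)
    (u v : ℝ → Euc d → ℝ) (huv : IsWeakSolution Ω T D F Ψ₁ Ψ₂ u₀ v₀ u v) :
    ∀ᵐ z : ℝ × Euc d ∂((volume.restrict (Ioo 0 T)).prod (volume.restrict Ω)),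
      (vl ≤ v z.1 z.2 ∧ v z.1 z.2 ≤ vr) ∧ (ul ≤ u z.1 z.2 ∧ u z.1 z.2 ≤ ur) := by
  have hfin : IsFiniteMeasure (volume.restrict Ω) :=
    isFiniteMeasure_restrict.2 hΩ_bdd.measure_lt_top.ne
  obtain ⟨Dm, DM, hDm, hDb⟩ := hD_bdd
  obtain ⟨FM, -, hFM⟩ := hF_bdd
  obtain ⟨Ψu, Ψv, hΨu, hΨv, hLip⟩ := hΨ
  have hD0 : ∀ a b, 0 ≤ D a b := fun a b => hDm.le.trans (hDb a b).1
  have hFc : Continuous fun a => F a 0 := by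
    refine (PiLp.continuous_toLp 2 _).comp (continuous_pi fun j => ?_)
    exact (hF j).continuous.comp (by fun_prop : Continuous fun a : ℝ => (a, (0 : ℝ)))
  -- One constant serves both equations: `Ψ₁` is compared only in its second variable, `Ψ₂` only in
  -- its first.
  set L := max Ψu Ψv with hLdef
  have hL0 : 0 ≤ L := hΨu.le.trans (le_max_left _ _)
  have hu_le : ∀ s : ℝ, Ψu * |s| ≤ L * |s| := fun s =>
    mul_le_mul_of_nonneg_right (le_max_left _ _) (abs_nonneg s)
  have hv_le : ∀ s : ℝ, Ψv * |s| ≤ L * |s| := fun s =>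
    mul_le_mul_of_nonneg_right (le_max_right _ _) (abs_nonneg s)
  have hL₁ : ∀ a b b', |Ψ₁ a b - Ψ₁ a b'| ≤ L * |b - b'| := fun a b b' => by
    have := (hLip a a b b').1
    rw [sub_self, abs_zero, mul_zero, zero_add] at this
    exact this.trans (hv_le _)
  have hL₂ : ∀ a a' b, |Ψ₂ a b - Ψ₂ a' b| ≤ L * |a - a'| := fun a a' b => by
    have := (hLip a a' b b).2
    rw [sub_self, abs_zero, mul_zero, add_zero] at this
    exact this.trans (hu_le _)
  have hv₀_mem : ∀ᵐ x ∂(volume.restrict Ω), vl ≤ v₀ x ∧ v₀ x ≤ vr := by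
    rw [hvl, hvr]
    exact MemLp.ae_mem_Icc_essInf_essSup hv₀
  have hright := huv.le_and_ge hT hD0 (f := fun a => F a 0) (fun a b => hF_u a b 0) hFc
    (fun s => hFM s 0) (k := ur) (l := vl) (L := L) hur hL0
    (fun a b hab => le_mul_max_of_antitone h_r.1 hΨ₁_u hΨ₁_v (fun b => hL₁ ur b vl) hab)
    (fun a b hb => by
      -- The lower bound for `Ψ₂` becomes the upper bound already proved, after exchanging the two
      -- variables and reflecting them; monotonicity survives both operations.
      have := le_mul_max_of_antitone (g := fun p q => -Ψ₂ (-q) (-p)) (k := -vl) (l := -ur)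
        (L := L) (a := -b) (b := -a) (by simpa using h_r.2)
        (fun q p p' hp => neg_le_neg (hΨ₂_v (-q) (neg_le_neg hp)))
        (fun p q q' hq => neg_le_neg (hΨ₂_u (-p) (neg_le_neg hq)))
        (fun q => by
          have := hL₂ ur (-q) vl
          simpa [add_comm, sub_eq_add_neg] using this) (neg_le_neg hb)
      simpa [add_comm, sub_eq_add_neg] using this)
    (hu₀_mem.mono fun x hx => hx.2) (hv₀_mem.mono fun x hx => hx.1)
  have hleft := huv.neg.le_and_ge hT (fun a b => hD0 _ _) (f := fun a => -F (-a) 0)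
    (fun a b => congrArg Neg.neg (hF_u (-a) (-b) 0)) (hFc.comp continuous_neg).neg
    (fun s => (norm_neg _).trans_le (hFM (-s) 0)) (k := -ul) (l := -vr) (L := L)
    (neg_nonneg.2 hul) hL0
    (fun a b hab => le_mul_max_of_antitone (g := fun a b => -Ψ₁ (-a) (-b)) (by simpa using h_l.2)
      (fun b a a' ha => neg_le_neg (hΨ₁_u (-b) (neg_le_neg ha)))
      (fun a b b' hb => neg_le_neg (hΨ₁_v (-a) (neg_le_neg hb)))
      (fun b => by
        have := hL₁ ul vr (-b)
        simpa [add_comm, sub_eq_add_neg] using this) hab)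
    (fun a b hb => by
      -- For the reflected system the two sign changes cancel, and only the exchange of variables
      -- remains.
      have := le_mul_max_of_antitone (g := fun p q => Ψ₂ q p) (k := vr) (l := ul)
        (L := L) (a := -b) (b := -a) h_l.1 hΨ₂_v hΨ₂_u (fun q => hL₂ q ul vr)
        (by linarith)
      simpa [add_comm, sub_eq_add_neg] using this)
    (hu₀_mem.mono fun x hx => neg_le_neg hx.1) (hv₀_mem.mono fun x hx => neg_le_neg hx.2)
  obtain ⟨U, V, -, -, hu, -, -, -, hv, -⟩ := huv
  have hfinal := ae_prod_of_ae_ae_mem hu.1 hv.1 (S := Icc ul ur ×ˢ Icc vl vr)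
    (measurableSet_Icc.prod measurableSet_Icc) (by
      filter_upwards [hright, hleft] with t h1 h2
      filter_upwards [h1, h2] with x e1 e2
      exact ⟨⟨neg_le_neg_iff.1 e2.1, e1.1⟩, ⟨e1.2, neg_le_neg_iff.1 e2.2⟩⟩)
  filter_upwards [hfinal] with z hz
  exact ⟨hz.2, hz.1⟩
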